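/- Let $G$ be a finite connected simple graph with shortest-path distance $d$, and for a sequence of vertices put $\ell(x_0,\ldots,x_k)=\sum_{i=0}^{k-1} d(x_i,x_{i+1})$. Let $\mathrm{MC}_{k,l}(G)$ be the free abelian group on the sequences $(x_0,\ldots,x_k)$ of vertices of $G$ (with $k\ge 0$) such that $x_i\ne x_{i+1}$ for all $i$ and $\ell(x_0,\ldots,x_k)=l$; it is $0$ if $k<0$ or $l<0$. For each $l$, these groups form a chain complex $\mathrm{MC}_{*,l}(G)$ with differential $\partial(x_0,\ldots,x_k)=\sum_{i=1}^{k-1}(-1)^i\,\partial_i(x_0,\ldots,x_k)$, where $\partial_i(x_0,\ldots,x_k)=(x_0,\ldots,\widehat{x_i},\ldots,x_k)$ if deleting $x_i$ does not change $\ell$, and $\partial_i(x_0,\ldots,x_k)=0$ otherwise. The magnitude homology groups of $G$ are $\mathrm{MH}_{k,l}(G)=H_k(\mathrm{MC}_{*,l}(G))$. **Theorem.** Fix an integer $m\ge 3$, and let $C_{2m}$ be the cycle graph with $2m$ vertices. 1. For all integers $k,l$, the group $\mathrm{MH}_{k,l}(C_{2m})$ is torsion-free. 2. Define $T:\mathbb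 Z\times\mathbb Z\to\mathbb Z$ recursively by - $T(k,l)=0$ if $k<0$ or $l<0$; - $T(0,0)=2m$ and $T(1,1)=4m$; - $T(k,l)=\max\{T(k-1,l-1),\,T(k-2,l-m)\}$ for all other $(k,l)$. Then for all integers $k,l$, the group $\mathrm{MH}_{k,l}(C_{2m})$ is finitely generated and $\operatorname{rk}\mathrm{MH}_{k,l}(C_{2m})=T(k,l)$. -/

import Mathlib

namespace SimpleGraph

universe u

/-- The length `ℓ(x₀, …, x_k) = d(x₀, x₁) + ⋯ + d(x_{k-1}, x_k)` of a sequence of vertices, for the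
shortest-path distance `d` (the value is `⊤` if two consecutive vertices are not connected). -/
noncomputable def seqLength {V : Type u} (G : SimpleGraph V) : List V → ℕ∞
  | [] => 0
  | [_] => 0
  | x :: y :: t => G.edist x y + seqLength G (y :: t)

/-- `x` is a generator of the magnitude chain group of bidegree `(k, l)`: it is a sequence
`(x₀, …, x_k)` of `k + 1 ≥ 1` vertices, consecutive vertices are distinct, and its length is `l`.
There are none if `k < 0` or `l < 0`. -/
def IsMagnitudeSeq {V : Type u} (G : SimpleGraph V) (k l : ℤ) (x : List V) : Prop :=
  x ≠ [] ∧ (x.length : ℤ) = k + 1 ∧ x.IsChain (· ≠ ·) ∧ ∃ n : ℕ, (n : ℤ) = l ∧ G.seqLength x = n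

/-- The magnitude chain group `MC_{k,l}(G)`: the free abelian group on the sequences above. -/
abbrev MagnitudeChain {V : Type u} (G : SimpleGraph V) (k l : ℤ) : Type u :=
  {x : List V // G.IsMagnitudeSeq k l x} →₀ ℤ

open Classical in
/-- The basis element of `MC_{k,l}(G)` given by a sequence, and `0` if the sequence is not a
generator of bidegree `(k, l)`. -/
noncomputable def magnitudeSingle {V : Type u} (G : SimpleGraph V) (k l : ℤ) (x : List V) :
    G.MagnitudeChain k l :=
  if h : G.IsMagnitudeSeq k l x then Finsupp.single ⟨x, h⟩ 1 else 0

/-- The map `MC_{i,l}(G) → MC_{j,l}(G)` sending a generator `x = (x₀, …, x_i)` to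
`∑_{1 ≤ a ≤ i - 1} (-1)^a ∂_a x`, where `∂_a x` is `x` with `x_a` deleted if the result is a
generator of bidegree `(j, l)`, and `0` otherwise. For `j = i - 1` the result is a generator if and
only if its length equals that of `x`, see `isMagnitudeSeq_eraseIdx_iff`. It is the zero map if
`j ≠ i - 1`. -/
noncomputable def magnitudeD {V : Type u} (G : SimpleGraph V) (l i j : ℤ) :
    G.MagnitudeChain i l →ₗ[ℤ] G.MagnitudeChain j l :=
  Finsupp.linearCombination ℤ fun x : {x : List V // G.IsMagnitudeSeq i l x} =>
    ∑ a ∈ Finset.Ico 1 (x.1.length - 1), (-1 : ℤ) ^ a • G.magnitudeSingle j l (x.1.eraseIdx a)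

theorem seqLength_le_cons {V : Type u} (G : SimpleGraph V) (a : V) (t : List V) :
    G.seqLength t ≤ G.seqLength (a :: t) := by
  cases t with
  | nil => simp [seqLength]
  | cons b s => simp [seqLength]

theorem seqLength_eraseIdx_le {V : Type u} (G : SimpleGraph V) (x : List V) (i : ℕ) :
    G.seqLength (x.eraseIdx i) ≤ G.seqLength x := by
  induction x generalizing i with
  | nil => simp
  | cons a t ih =>
    cases i with
    | zero => simpa using seqLength_le_cons G a t
    | succ i =>
      cases t with
      | nil => simp
      | cons b s =>
        cases i with
        | zero =>
          cases s with
          | nil => simp [seqLength]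
          | cons c r =>
            simp only [List.eraseIdx_cons_succ, List.eraseIdx_cons_zero, seqLength]
            rw [← add_assoc]
            gcongr
            exact G.edist_triangle
        | succ i =>
          have := ih (i + 1)
          simp only [List.eraseIdx_cons_succ, seqLength] at this ⊢
          gcongr

theorem isChain_eraseIdx {V : Type u} (G : SimpleGraph V) (x : List V) (i : ℕ)
    (hx : x.IsChain (· ≠ ·)) (hfin : G.seqLength x ≠ ⊤)
    (heq : G.seqLength (x.eraseIdx i) = G.seqLength x) :
    (x.eraseIdx i).IsChain (· ≠ ·) := by
  induction x generalizing i with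
  | nil => simp
  | cons a t ih =>
    cases i with
    | zero => simpa using hx.tail
    | succ i =>
      cases t with
      | nil => simp
      | cons b s =>
        rw [List.isChain_cons_cons] at hx
        cases i with
        | zero =>
          cases s with
          | nil => simp
          | cons c r =>
            simp only [List.eraseIdx_cons_succ, List.eraseIdx_cons_zero, seqLength] at heq hfin ⊢
            have h2 := hx.2
            rw [List.isChain_cons_cons] at h2
            rw [List.isChain_cons_cons]
            refine ⟨?_, h2.2⟩
            rintro rfl
            have hp : 0 < G.edist a b := G.edist_pos_of_ne hx.1
            rw [edist_self, zero_add] at heq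
            generalize G.edist a b = p at *
            generalize G.edist b a = q at *
            generalize G.seqLength (a :: r) = s at *
            have hp' : p ≠ ⊤ := by rintro rfl; simp at hfin
            have hq' : q ≠ ⊤ := by rintro rfl; simp at hfin
            have hs' : s ≠ ⊤ := by rintro rfl; simp at hfin
            lift p to ℕ using hp'
            lift q to ℕ using hq'
            lift s to ℕ using hs'
            norm_cast at heq hp
            omega
        | succ i =>
          simp only [List.eraseIdx_cons_succ, seqLength] at heq hfin ⊢
          have h1 : G.edist a b ≠ ⊤ := by
            intro h; rw [h] at hfin; simp at hfin
          have h2 : G.seqLength (b :: s) ≠ ⊤ := by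
            intro h; rw [h] at hfin; simp at hfin
          have := ih (i + 1) hx.2 h2 (by
            simpa using (ENat.add_right_injective_of_ne_top h1) heq)
          rw [List.eraseIdx_cons_succ] at this
          rw [List.isChain_cons_cons]
          exact ⟨hx.1, this⟩

/-- Deleting an interior vertex of a generator gives a generator if and only if it preserves the
length. -/
theorem isMagnitudeSeq_eraseIdx_iff {V : Type u} (G : SimpleGraph V) {k l : ℤ} {x : List V}
    (hx : G.IsMagnitudeSeq k l x) {a : ℕ} (ha : a ∈ Finset.Ico 1 (x.length - 1)) :
    G.IsMagnitudeSeq (k - 1) l (x.eraseIdx a) ↔ G.seqLength (x.eraseIdx a) = G.seqLength x := by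
  obtain ⟨_, hlen, hch, n, hn, hl⟩ := hx
  rw [Finset.mem_Ico] at ha
  have hlt : a < x.length := by omega
  have hlen' := List.length_eraseIdx_of_lt hlt
  constructor
  · rintro ⟨_, _, _, n', hn', hl'⟩
    rw [hl, hl']
    have : n' = n := by omega
    rw [this]
  · intro h
    refine ⟨?_, by omega, isChain_eraseIdx G x a hch (by rw [hl]; simp) h, n, hn, h.trans hl⟩
    intro h0
    rw [h0] at hlen'
    simp at hlen'
    omega

theorem sum_alternating_erase {M : Type*} [AddCommGroup M] (n : ℕ) (f : ℕ → ℕ → M)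
    (hf : ∀ a b, a ≤ b → f a b = f (b + 1) a) :
    ∑ a ∈ Finset.Ico 1 (n + 1), ∑ b ∈ Finset.Ico 1 n, (-1 : ℤ) ^ (a + b) • f a b = 0 := by
  rw [← Finset.sum_product']
  refine Finset.sum_involution
    (fun p _ => if p.1 ≤ p.2 then (p.2 + 1, p.1) else (p.2, p.1 - 1)) ?_ ?_ ?_ ?_
  · rintro ⟨a, b⟩ _
    by_cases h : a ≤ b
    · simp only [h, if_true]
      rw [← hf a b h, ← add_smul, show b + 1 + a = (a + b) + 1 by ring, pow_succ]
      simp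
    · obtain ⟨c, rfl⟩ : ∃ c, a = c + 1 := ⟨a - 1, by omega⟩
      simp only [h, if_false, Nat.add_sub_cancel]
      rw [hf b c (by omega), ← add_smul, show c + 1 + b = (b + c) + 1 by ring, pow_succ]
      simp
  · rintro ⟨a, b⟩ _ _ h
    by_cases h' : a ≤ b
    · simp only [h', if_true, Prod.mk.injEq] at h
      omega
    · simp only [h', if_false, Prod.mk.injEq] at h
      omega
  · rintro ⟨a, b⟩ h
    simp only [Finset.mem_product, Finset.mem_Ico] at h
    by_cases h' : a ≤ b
    · simp only [h', if_true, Finset.mem_product, Finset.mem_Ico]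
      omega
    · simp only [h', if_false, Finset.mem_product, Finset.mem_Ico]
      omega
  · rintro ⟨a, b⟩ _
    by_cases h' : a ≤ b
    · simp [h', show ¬ (b + 1 ≤ a) by omega]
    · obtain ⟨c, rfl⟩ : ∃ c, a = c + 1 := ⟨a - 1, by omega⟩
      simp [h', show b ≤ c by omega]

theorem eraseIdx_eraseIdx_of_le {α : Type*} (x : List α) (a b : ℕ) (h : a ≤ b) :
    (x.eraseIdx a).eraseIdx b = (x.eraseIdx (b + 1)).eraseIdx a := by
  induction x generalizing a b with
  | nil => simp
  | cons c t ih =>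
    cases a with
    | zero => simp
    | succ a =>
      obtain ⟨b, rfl⟩ : ∃ b', b = b' + 1 := ⟨b - 1, by omega⟩
      simp only [List.eraseIdx_cons_succ]
      rw [ih a b (by omega)]

theorem magnitudeD_single {V : Type u} (G : SimpleGraph V) (l i j : ℤ)
    (x : {x : List V // G.IsMagnitudeSeq i l x}) :
    G.magnitudeD l i j (Finsupp.single x 1) =
      ∑ a ∈ Finset.Ico 1 (x.1.length - 1),
        (-1 : ℤ) ^ a • G.magnitudeSingle j l (x.1.eraseIdx a) := by
  simp [magnitudeD]

theorem magnitudeD_magnitudeSingle_eraseIdx {V : Type u} (G : SimpleGraph V) (l i : ℤ)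
    (x : {x : List V // G.IsMagnitudeSeq i l x}) (a : ℕ)
    (ha : a ∈ Finset.Ico 1 (x.1.length - 1)) :
    G.magnitudeD l (i - 1) (i - 1 - 1) (G.magnitudeSingle (i - 1) l (x.1.eraseIdx a)) =
      ∑ b ∈ Finset.Ico 1 (x.1.length - 2),
        (-1 : ℤ) ^ b • G.magnitudeSingle (i - 1 - 1) l ((x.1.eraseIdx a).eraseIdx b) := by
  have ha' := Finset.mem_Ico.1 ha
  have hlen : (x.1.eraseIdx a).length = x.1.length - 1 :=
    List.length_eraseIdx_of_lt (by omega)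
  by_cases h : G.IsMagnitudeSeq (i - 1) l (x.1.eraseIdx a)
  · rw [show G.magnitudeSingle (i - 1) l (x.1.eraseIdx a) = Finsupp.single ⟨_, h⟩ 1 by
      simp [magnitudeSingle, h], magnitudeD_single, hlen, Nat.sub_sub]
  · rw [show G.magnitudeSingle (i - 1) l (x.1.eraseIdx a) = 0 by simp [magnitudeSingle, h], map_zero]
    symm
    refine Finset.sum_eq_zero fun b _ => ?_
    have : ¬ G.IsMagnitudeSeq (i - 1 - 1) l ((x.1.eraseIdx a).eraseIdx b) := by
      rintro ⟨_, _, _, n, hn, hl⟩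
      apply h
      rw [isMagnitudeSeq_eraseIdx_iff G x.2 ha]
      obtain ⟨_, _, _, n', hn', hl'⟩ := x.2
      refine le_antisymm (seqLength_eraseIdx_le G _ _) ?_
      have h1 := seqLength_eraseIdx_le G (x.1.eraseIdx a) b
      rw [hl] at h1
      rw [hl', show n' = n by omega]
      exact h1
    simp [magnitudeSingle, this]

theorem magnitudeD_comp {V : Type u} (G : SimpleGraph V) (l i : ℤ) :
    G.magnitudeD l (i - 1) (i - 1 - 1) ∘ₗ G.magnitudeD l i (i - 1) = 0 := by
  refine Finsupp.lhom_ext' fun x => LinearMap.ext_ring ?_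
  simp only [LinearMap.comp_apply, Finsupp.lsingle_apply, LinearMap.zero_apply]
  rw [magnitudeD_single, map_sum, Finset.sum_congr rfl fun a ha => by
    rw [map_smul, magnitudeD_magnitudeSingle_eraseIdx G l i x a ha, Finset.smul_sum,
      Finset.sum_congr rfl fun b _ => by rw [smul_smul, ← pow_add]]]
  by_cases hn : x.1.length < 3
  · rw [Finset.Ico_eq_empty (by omega), Finset.sum_empty]
  · obtain ⟨n, hn'⟩ : ∃ n, x.1.length = n + 2 := ⟨x.1.length - 2, by omega⟩
    rw [hn']
    exact sum_alternating_erase n _ fun a b hab => by rw [eraseIdx_eraseIdx_of_le _ _ _ hab]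

/-- The magnitude chain complex `MC_{*,l}(G)`, indexed by `ℤ`, with differential lowering the degree
by one. -/
noncomputable def magnitudeComplex {V : Type u} (G : SimpleGraph V) (l : ℤ) :
    ChainComplex (ModuleCat.{u} ℤ) ℤ where
  X k := ModuleCat.of ℤ (G.MagnitudeChain k l)
  d i j := ModuleCat.ofHom (G.magnitudeD l i j)
  shape i j hij := by
    ext1
    refine Finsupp.lhom_ext' fun x => LinearMap.ext_ring ?_
    change G.magnitudeD l i j (Finsupp.single x 1) = 0
    rw [magnitudeD_single]
    refine Finset.sum_eq_zero fun a ha => ?_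
    rw [Finset.mem_Ico] at ha
    have : ¬ G.IsMagnitudeSeq j l (x.1.eraseIdx a) := by
      rintro ⟨_, h, _⟩
      rw [List.length_eraseIdx_of_lt (by omega)] at h
      have := x.2.2.1
      apply hij
      simp only [ComplexShape.down_Rel]
      omega
    simp [magnitudeSingle, this]
  d_comp_d' i j k hij hjk := by
    simp only [ComplexShape.down_Rel] at hij hjk
    obtain rfl : j = i - 1 := by omega
    obtain rfl : k = i - 1 - 1 := by omega
    rw [← ModuleCat.ofHom_comp, magnitudeD_comp]
    rfl

/-- The magnitude homology group `MH_{k,l}(G) = H_k(MC_{*,l}(G))`. -/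
noncomputable abbrev magnitudeHomology {V : Type u} (G : SimpleGraph V) (k l : ℤ) :
    ModuleCat.{u} ℤ :=
  (G.magnitudeComplex l).homology k

end SimpleGraph

/-- The function `T : ℤ × ℤ → ℤ` attached to the cycle with `2 * m` vertices. -/
def evenCycleRank (m : ℕ) (k l : ℤ) : ℤ :=
  if k < 0 ∨ l < 0 then 0
  else if k = 0 ∧ l = 0 then 2 * m
  else if k = 1 ∧ l = 1 then 4 * m
  else max (evenCycleRank m (k - 1) (l - 1)) (evenCycleRank m (k - 2) (l - m))
termination_by (k + 1).toNat
decreasing_by all_goals omega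

/-! ### Sequences and the deletion differential -/

/-! Deleting an interior vertex preserves length exactly when the steps before and after it turn the
same way and total at most `m` (`CyclicStep.d_add_iff`). In particular, an antipodal step never
merges with a neighbour.

In degrees `k > 0` the chains are the sum of two subcomplexes: first step forward or antipodal, and
first step backward or antipodal. Reversing the direction of the cycle (`CyclicStep.op`) exchanges
them, so one argument serves both. In the forward one, a first step of size at least two can be
split after one unit. This is a contracting homotopy up to a defect `J ∘ R` (`homotopy`), where `J`
prefixes a unit step. Hence, away from bidegree `(1, 1)`, a forward cycle is a boundary plus `J` of
a backward cycle of bidegree `(k - 1, l - 1)`. Induction on `k`, switching direction each time,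
shows that each half has homology only for `k = l` (`exists_D_eq_of_mem_fwd`).

The intersection of the halves consists of the chains with antipodal first step. Removing the first
vertex identifies it, up to sign, with the whole complex shifted by `(1, m)` (`M_strip`, `D_M`). So
for `k ≥ 1` and `l ≠ k` the Mayer–Vietoris connecting map gives `MH_{k,l} ≅ MH_{k-2,l-m}`
(`hasFreeHomology_step`). For `k = l ≥ 1` there are no boundaries, and the cycles are spanned by
unit-step zigzags, one for each last vertex and each initial direction: `4m` in all
(`hasFreeHomology_diag`). At the origin the `2m` vertices form a basis. Thus every group is free,
and the recursion for `T` has the same period and the same initial values (`evenCycleRank_step`,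
`evenCycleRank_diag`). -/

/-- Formal integer combinations of finite sequences. -/
abbrev ListChain (V : Type) := List V →₀ ℤ

namespace ListChain

variable {V : Type}

/-- Prepending a fixed entry to every sequence. -/
noncomputable def cons (x : V) : ListChain V →ₗ[ℤ] ListChain V :=
  Finsupp.lmapDomain ℤ ℤ (List.cons x)

@[simp] theorem cons_single (x : V) (w : List V) (n : ℤ) :
    cons x (Finsupp.single w n) = Finsupp.single (x :: w) n := by
  simp [cons]

/-- Supported chains are spanned by single sequences; through this every claim about linear maps on
chains below is checked on one sequence at a time. -/
theorem map_mem_of_mem_supported {M : Type*} [AddCommGroup M] {s : Set (List V)}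
    (T : ListChain V →ₗ[ℤ] M) (N : Submodule ℤ M)
    (h : ∀ w ∈ s, T (Finsupp.single w 1) ∈ N) {z : ListChain V}
    (hz : z ∈ Finsupp.supported ℤ ℤ s) : T z ∈ N := by
  rw [Finsupp.supported_eq_span_single] at hz
  have : Submodule.span ℤ ((fun i => Finsupp.single i (1 : ℤ)) '' s) ≤ N.comap T := by
    rw [Submodule.span_le]
    rintro _ ⟨w, hw, rfl⟩
    exact h w hw
  exact this hz

theorem map_eq_of_mem_supported {M : Type*} [AddCommGroup M] {s : Set (List V)}
    (T T' : ListChain V →ₗ[ℤ] M)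
    (h : ∀ w ∈ s, T (Finsupp.single w 1) = T' (Finsupp.single w 1)) {z : ListChain V}
    (hz : z ∈ Finsupp.supported ℤ ℤ s) : T z = T' z := by
  have := map_mem_of_mem_supported (T - T') ⊥ (fun w hw => by simp [h w hw]) hz
  simpa [sub_eq_zero] using this

theorem single_mem {s : Set (List V)} {w : List V} (h : w ∈ s) :
    (Finsupp.single w 1 : ListChain V) ∈ Finsupp.supported ℤ ℤ s :=
  Finsupp.single_mem_supported ℤ 1 h

theorem cons_mem {s t : Set (List V)} {x : V} (h : ∀ w ∈ s, x :: w ∈ t) {z : ListChain V}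
    (hz : z ∈ Finsupp.supported ℤ ℤ s) : cons x z ∈ Finsupp.supported ℤ ℤ t :=
  map_mem_of_mem_supported _ _ (fun w hw => by simpa using single_mem (h w hw)) hz

theorem mem_mono {s t : Set (List V)} (h : s ⊆ t) {z : ListChain V}
    (hz : z ∈ Finsupp.supported ℤ ℤ s) : z ∈ Finsupp.supported ℤ ℤ t :=
  Finsupp.supported_mono h hz

theorem mem_inter {s t : Set (List V)} {z : ListChain V} (hs : z ∈ Finsupp.supported ℤ ℤ s)
    (ht : z ∈ Finsupp.supported ℤ ℤ t) : z ∈ Finsupp.supported ℤ ℤ (s ∩ t) := by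
  rw [Finsupp.supported_inter]
  exact ⟨hs, ht⟩

theorem eq_zero_of_mem {s : Set (List V)} (h : ∀ w, w ∉ s) {z : ListChain V}
    (hz : z ∈ Finsupp.supported ℤ ℤ s) : z = 0 := by
  have hs : s = ∅ := Set.eq_empty_of_forall_notMem h
  subst hs
  simpa using hz

variable (d : V → V → ℕ)

/-- `Sq d k l w`: the sequence `w` has `k + 1` entries, consecutive entries are distinct and
its length for `d` is `l`. -/
def Sq : ℤ → ℤ → List V → Prop
  | _, _, [] => False
  | k, l, [_] => k = 0 ∧ l = 0
  | k, l, x :: y :: w => x ≠ y ∧ Sq (k - 1) (l - d x y) (y :: w)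

/-- The deletion differential of `x :: w`, with the first entry `x` removed from all its terms. -/
noncomputable def tailD : V → List V → ListChain V
  | x, y :: z :: w =>
    (if d x z = d x y + d y z then Finsupp.single (z :: w) 1 else 0) - cons y (tailD y (z :: w))
  | _, _ => 0

/-- The deletion differential on a single sequence. -/
noncomputable def listD : List V → ListChain V
  | [] => 0
  | x :: w => cons x (tailD d x w)

/-- The deletion differential. -/
noncomputable def D : ListChain V →ₗ[ℤ] ListChain V :=
  Finsupp.linearCombination ℤ (listD d)

@[simp] theorem D_single (w : List V) : D d (Finsupp.single w 1) = listD d w := by simp [D]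

theorem listD_pair (x y : V) : listD d [x, y] = 0 := by simp [listD, tailD]

theorem listD_cons (x y z : V) (w : List V) : listD d (x :: y :: z :: w) =
    (if d x z = d x y + d y z then Finsupp.single (x :: z :: w) 1 else 0) -
      cons x (cons y (tailD d y (z :: w))) := by
  rw [listD, tailD, map_sub]
  split_ifs <;> simp

theorem listD_cons_of_ne {x y z : V} (w : List V) (h : d x z ≠ d x y + d y z) :
    listD d (x :: y :: z :: w) = -cons x (cons y (tailD d y (z :: w))) := by
  rw [listD_cons, if_neg h, zero_sub]

/-- The chains on sequences with `k + 1` entries and length `l`. -/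
abbrev Chains (k l : ℤ) : Submodule ℤ (ListChain V) := Finsupp.supported ℤ ℤ {w | Sq d k l w}

theorem Sq.nonneg {k l : ℤ} {w : List V} (h : Sq d k l w) : 0 ≤ k ∧ 0 ≤ l := by
  induction w generalizing k l with
  | nil => exact h.elim
  | cons x w ih =>
    cases w with
    | nil => simp only [Sq] at h; omega
    | cons y w => have := ih h.2; omega

theorem Sq.le (hd : ∀ x y, x ≠ y → 0 < d x y) {k l : ℤ} {w : List V} (h : Sq d k l w) : k ≤ l := by
  induction w generalizing k l with
  | nil => exact h.elim
  | cons x w ih =>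
    cases w with
    | nil => simp only [Sq] at h; omega
    | cons y w => have := ih h.2; have := hd x y h.1; omega

theorem Sq.one_le {k l : ℤ} {x y : V} {w : List V} (h : Sq d k l (x :: y :: w)) : 1 ≤ k := by
  have := Sq.nonneg d h.2; omega

theorem tailD_mem (hd : ∀ x y, x ≠ y → 0 < d x y) (hd0 : ∀ x, d x x = 0)
    {k l : ℤ} {x : V} {w : List V} (h : Sq d k l (x :: w)) :
    tailD d x w ∈ Finsupp.supported ℤ ℤ {t | Sq d (k - 1) l (x :: t)} := by
  induction w generalizing k l x with
  | nil => simp [tailD]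
  | cons y w ih =>
    cases w with
    | nil => simp [tailD]
    | cons z w =>
      rw [tailD]
      refine sub_mem ?_ (cons_mem ?_ (ih h.2))
      · split_ifs with hxz
        · refine single_mem ?_
          refine ⟨?_, ?_⟩
          · rintro rfl
            have := hd x y h.1
            rw [hd0] at hxz
            omega
          · have := h.2.2
            rwa [sub_sub l, ← Nat.cast_add, ← hxz] at this
        · exact zero_mem _
      · intro t ht
        exact ⟨h.1, ht⟩

theorem D_mem (hd : ∀ x y, x ≠ y → 0 < d x y) (hd0 : ∀ x, d x x = 0) {k l : ℤ} {z : ListChain V}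
    (hz : z ∈ Chains d k l) : D d z ∈ Chains d (k - 1) l := by
  refine map_mem_of_mem_supported _ _ (fun w hw => ?_) hz
  rw [D_single]
  cases w with
  | nil => exact hw.elim
  | cons x w => exact cons_mem (fun t ht => ht) (tailD_mem d hd hd0 hw)

end ListChain

/-! ### Cyclic arrangements -/

/-- A cyclic arrangement of `2 * m` points with distance `d`: `p x y` is the number of steps from
`x` to `y` in the positive direction. -/
structure CyclicStep {V : Type} (m : ℕ) (d : V → V → ℕ) where
  p : V → V → ℕ
  s : V → V
  pr : V → V
  ant : V → V
  lt : ∀ x y, p x y < 2 * m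
  eq_zero : ∀ x y, p x y = 0 ↔ x = y
  add : ∀ x y z, p x z = p x y + p y z ∨ p x z + 2 * m = p x y + p y z
  p_s : ∀ x, p x (s x) = 1
  p_pr : ∀ x, p (pr x) x = 1
  p_ant : ∀ x, p x (ant x) = m
  d_eq : ∀ x y, d x y = min (p x y) (2 * m - p x y)

namespace CyclicStep

open ListChain

variable {V : Type} {m : ℕ} {d : V → V → ℕ} (C : CyclicStep m d)

include C

theorem p_self (x : V) : C.p x x = 0 := (C.eq_zero x x).2 rfl

theorem p_pos {x y : V} (h : x ≠ y) : 0 < C.p x y :=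
  Nat.pos_of_ne_zero fun h' => h ((C.eq_zero x y).1 h')

theorem p_add_swap {x y : V} (h : x ≠ y) : C.p x y + C.p y x = 2 * m := by
  have := C.add x y x
  have := C.p_self x
  have := C.p_pos h
  omega

theorem eq_of_p_eq {x y z : V} (h : C.p x y = C.p x z) : y = z := by
  have := C.add x y z
  have := C.lt y z
  exact (C.eq_zero y z).1 (by omega)

theorem d_pos (x y : V) (h : x ≠ y) : 0 < d x y := by
  have := C.p_pos h
  have := C.lt x y
  rw [C.d_eq]
  omega

theorem d_self (x : V) : d x x = 0 := by
  rw [C.d_eq, C.p_self]; simp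

/-- The same arrangement with the opposite direction. -/
def op (hm : 0 < m) : CyclicStep m d where
  p x y := C.p y x
  s := C.pr
  pr := C.s
  ant := C.ant
  lt x y := C.lt y x
  eq_zero x y := by rw [C.eq_zero]; exact eq_comm
  add x y z := by have := C.add z y x; omega
  p_s := C.p_pr
  p_pr := C.p_s
  p_ant x := by
    have h : x ≠ C.ant x := by
      intro h
      have := C.p_ant x
      rw [← h, C.p_self] at this
      omega
    have := C.p_add_swap h
    have := C.p_ant x
    omega
  d_eq x y := by
    by_cases h : x = y
    · subst h; rw [C.d_eq, C.p_self]
    · have := C.p_add_swap h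
      have := C.p_pos h
      rw [C.d_eq]; omega

theorem p_ant' (hm : 0 < m) (x : V) : C.p (C.ant x) x = m := (C.op hm).p_ant x

theorem D_mem' {k l : ℤ} {z : ListChain V} (hz : z ∈ Chains d k l) : D d z ∈ Chains d (k - 1) l :=
  D_mem d C.d_pos C.d_self hz

/-- Condition for deletion of `y` in `x, y, z` to preserve length. -/
theorem d_add_iff {x y z : V} (hxy : x ≠ y) (hyz : y ≠ z) :
    d x z = d x y + d y z ↔
      C.p x y + C.p y z ≤ m ∨ (m ≤ C.p x y ∧ m ≤ C.p y z ∧ 3 * m ≤ C.p x y + C.p y z) := by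
  have := C.p_pos hxy
  have := C.p_pos hyz
  have := C.lt x y
  have := C.lt y z
  have := C.lt x z
  have := C.add x y z
  rw [C.d_eq, C.d_eq, C.d_eq]
  omega

end CyclicStep

/-! ### Chains with forward first step: splitting homotopy and acyclicity -/

namespace CyclicStep

open ListChain

variable {V : Type} {m : ℕ} {d : V → V → ℕ} (C : CyclicStep m d)

/-- The first step of the sequence goes at most `m` in the positive direction. -/
def Fwd : List V → Prop
  | x :: y :: _ => C.p x y ≤ m
  | _ => False

/-- The chains on sequences of bidegree `(k, l)` whose first step is positive or antipodal. -/
abbrev FwdChains (k l : ℤ) : Submodule ℤ (ListChain V) :=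
  Finsupp.supported ℤ ℤ {w | Sq d k l w ∧ C.Fwd w}

theorem FwdChains_le (k l : ℤ) : C.FwdChains k l ≤ Chains d k l :=
  Finsupp.supported_mono fun _ h => h.1

/-- `x, y, …` is sent to `x, s x, y, …` if the first step is positive of size between `2` and
`m`. -/
noncomputable def splitFirst : ListChain V →ₗ[ℤ] ListChain V :=
  Finsupp.linearCombination ℤ fun
    | x :: y :: w => if 2 ≤ C.p x y ∧ C.p x y ≤ m then Finsupp.single (x :: C.s x :: y :: w) 1 else 0
    | _ => 0

/-- Prepends to a sequence the predecessor of its first entry. -/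
def prependPr : List V → List V
  | y :: w => C.pr y :: y :: w
  | [] => []

/-- The linear extension of `prependPr`. -/
noncomputable def J : ListChain V →ₗ[ℤ] ListChain V := Finsupp.lmapDomain ℤ ℤ C.prependPr

/-- The defect of `splitFirst` as a contracting homotopy is `J` composed with this map. -/
noncomputable def R : ListChain V →ₗ[ℤ] ListChain V :=
  Finsupp.linearCombination ℤ fun
    | [x, y] => if C.p x y = 1 then Finsupp.single [y] 1 else 0
    | x :: y :: z :: w =>
      if C.p x y = 1 then (if m ≤ C.p y z then Finsupp.single (y :: z :: w) 1 else 0)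
      else if C.p x y + C.p y z = m + 1 then Finsupp.single (C.s x :: z :: w) 1 else 0
    | _ => 0

@[simp] theorem J_single (w : List V) (n : ℤ) :
    C.J (Finsupp.single w n) = Finsupp.single (C.prependPr w) n := by simp [J]

theorem J_cons (x : V) (u : ListChain V) : C.J (cons x u) = cons (C.pr x) (cons x u) := by
  have : C.J ∘ₗ cons x = cons (C.pr x) ∘ₗ cons x := by
    ext w : 2
    simp [prependPr]
  exact LinearMap.congr_fun this u

theorem splitFirst_cons (x y : V) (u : ListChain V) : C.splitFirst (cons x (cons y u)) =
    if 2 ≤ C.p x y ∧ C.p x y ≤ m then cons x (cons (C.s x) (cons y u)) else 0 := by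
  split_ifs with h
  · have : C.splitFirst ∘ₗ cons x ∘ₗ cons y = cons x ∘ₗ cons (C.s x) ∘ₗ cons y := by
      ext w : 2
      simp [splitFirst, h]
    exact LinearMap.congr_fun this u
  · have : C.splitFirst ∘ₗ cons x ∘ₗ cons y = 0 := by
      ext w : 2
      simp only [splitFirst, LinearMap.comp_apply, Finsupp.lsingle_apply, cons_single,
        Finsupp.linearCombination_single, if_neg h, smul_zero, LinearMap.zero_apply]
    exact LinearMap.congr_fun this u

theorem eq_s {x y : V} (h : C.p x y = 1) : y = C.s x := C.eq_of_p_eq (h.trans (C.p_s x).symm)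

theorem pr_s (hm : 0 < m) (x : V) : C.pr (C.s x) = x :=
  ((C.op hm).eq_s (C.p_s x)).symm

theorem p_s_left {x y : V} (h : 1 ≤ C.p x y) : C.p (C.s x) y = C.p x y - 1 := by
  have := C.add x (C.s x) y
  have := C.lt (C.s x) y
  have := C.lt x y
  have := C.p_s x
  omega

theorem ne_of_p_pos {x y : V} (h : 0 < C.p x y) : x ≠ y := by
  rintro rfl
  simp [C.p_self] at h

/-- Splitting the first step, then deleting the inserted vertex, returns the sequence; most other
terms cancel against split faces. The two sides disagree only at the threshold for merging the first
steps, and `J ∘ R` records that disagreement. -/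
theorem homotopy (hm : 3 ≤ m) {k l : ℤ} {z : ListChain V} (hz : z ∈ C.FwdChains k l) :
    z = D d (C.splitFirst z) + C.splitFirst (D d z) + C.J (C.R z) := by
  refine map_eq_of_mem_supported LinearMap.id
    (D d ∘ₗ C.splitFirst + C.splitFirst ∘ₗ D d + C.J ∘ₗ C.R) (fun w hw => ?_) hz
  simp only [LinearMap.id_apply, LinearMap.add_apply, LinearMap.comp_apply, D_single]
  obtain ⟨h1, h2⟩ := hw
  match w, h1, h2 with
  | [x, y], h1, h2 =>
    have hxy := C.p_pos h1.1
    simp only [Fwd] at h2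
    rw [listD_pair, map_zero, add_zero]
    simp only [splitFirst, R, Finsupp.linearCombination_single, one_smul]
    by_cases h : C.p x y = 1
    · have := C.eq_s h
      subst this
      simp [h, prependPr, C.pr_s (by omega : 0 < m)]
    · rw [if_pos (by omega), if_neg h, map_zero, add_zero, D_single, listD_cons]
      have h3 := C.p_s_left hxy
      have h4 := C.p_s x
      rw [if_pos]
      · simp [tailD]
      · rw [C.d_add_iff (C.ne_of_p_pos (by omega)) (C.ne_of_p_pos (by omega))]
        omega
  | x :: y :: z :: w, h1, h2 =>
    have hxy := C.p_pos h1.1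
    have hyz := C.p_pos h1.2.1
    have hyz' := C.lt y z
    simp only [Fwd] at h2
    have h4 := C.p_s x
    rw [listD_cons, map_sub, splitFirst_cons]
    have hc := C.d_add_iff h1.1 h1.2.1
    have hadd := C.add x y z
    have hlt := C.lt x z
    have hS : C.splitFirst (if d x z = d x y + d y z then Finsupp.single (x :: z :: w) 1 else 0)
        = if C.p x y + C.p y z ≤ m then Finsupp.single (x :: C.s x :: z :: w) 1 else 0 := by
      by_cases h : C.p x y + C.p y z ≤ m
      · rw [if_pos (hc.2 (Or.inl h)), if_pos h]
        simp only [splitFirst, Finsupp.linearCombination_single, one_smul]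
        rw [if_pos (by omega)]
      · rw [if_neg (by rw [hc]; omega), if_neg h, map_zero]
    rw [hS]
    simp only [splitFirst, R, Finsupp.linearCombination_single, one_smul]
    -- A unit first step cannot be split. If the next step is forward and shorter than `m`, deleting
    -- `y` and splitting again restores the sequence; otherwise the sequence itself is the defect,
    -- namely `J` of its tail.
    by_cases h : C.p x y = 1
    · have hy := C.eq_s h
      subst hy
      have e : ¬(2 ≤ C.p x (C.s x) ∧ C.p x (C.s x) ≤ m) := by omega
      rw [if_neg e, if_neg e, if_pos h, map_zero, zero_add, sub_zero]
      by_cases h5 : m ≤ C.p (C.s x) z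
      · rw [if_neg (by omega), if_pos h5, zero_add, J_single, prependPr, C.pr_s (by omega)]
      · rw [if_pos (by omega), if_neg h5, map_zero, add_zero]
    · have h3 := C.p_s_left hxy
      have e : 2 ≤ C.p x y ∧ C.p x y ≤ m := by omega
      rw [if_pos e, if_pos e, if_neg h, D_single, listD_cons]
      have hc1 := C.d_add_iff (C.ne_of_p_pos (by omega : 0 < C.p x (C.s x)))
        (C.ne_of_p_pos (by omega : 0 < C.p (C.s x) y))
      have hc2 := C.d_add_iff (C.ne_of_p_pos (by omega : 0 < C.p (C.s x) y)) h1.2.1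
      rw [if_pos (by rw [hc1]; omega), tailD, map_sub, map_sub]
      by_cases h5 : C.p x y + C.p y z ≤ m
      · have e' : C.p x y + C.p y z ≠ m + 1 := by omega
        rw [if_pos h5, if_neg e', if_pos (by rw [hc2]; omega)]
        simp
      · rw [if_neg h5]
        -- Seen from `s x`, the step to `y` is one shorter, so `y` can be deleted after splitting
        -- but not before exactly when the total is `m + 1`. The surplus term `x, s x, z, …` is `J`
        -- of a sequence starting at `s x`.
        by_cases h6 : C.p x y + C.p y z = m + 1
        · rw [if_pos h6, if_pos (by rw [hc2]; omega)]
          simp only [cons_single, J_single, prependPr, C.pr_s (by omega : 0 < m)]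
          abel
        · rw [if_neg h6, if_neg (by rw [hc2]; omega)]
          simp

theorem splitFirst_mem {k l : ℤ} {z : ListChain V} (hz : z ∈ C.FwdChains k l) :
    C.splitFirst z ∈ C.FwdChains (k + 1) l := by
  refine map_mem_of_mem_supported _ _ (fun w hw => ?_) hz
  obtain ⟨h1, h2⟩ := hw
  match w, h1, h2 with
  | x :: y :: w, h1, h2 =>
    simp only [splitFirst, Finsupp.linearCombination_single, one_smul]
    split_ifs with h
    · have h4 := C.p_s x
      have h3 := C.p_s_left (by omega : 1 ≤ C.p x y)
      refine single_mem ⟨⟨C.ne_of_p_pos (by omega), C.ne_of_p_pos (by omega), ?_⟩, ?_⟩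
      · convert h1.2 using 1
        · ring
        · rw [C.d_eq, C.d_eq, C.d_eq]; omega
      · simp only [Fwd]; omega
    · exact zero_mem _

theorem R_mem (hm : 3 ≤ m) {k l : ℤ} {z : ListChain V} (hz : z ∈ C.FwdChains k l) :
    C.R z ∈ Chains d (k - 1) (l - 1) := by
  refine map_mem_of_mem_supported _ _ (fun w hw => ?_) hz
  obtain ⟨h1, h2⟩ := hw
  match w, h1, h2 with
  | [x, y], h1, h2 =>
    simp only [R, Finsupp.linearCombination_single, one_smul]
    split_ifs with h
    · refine single_mem ?_
      have := h1.2
      rwa [C.d_eq, h, min_eq_left (by omega)] at this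
    · exact zero_mem _
  | x :: y :: z :: w, h1, h2 =>
    have hxy := C.p_pos h1.1
    simp only [Fwd] at h2
    simp only [R, Finsupp.linearCombination_single, one_smul]
    split_ifs with h h' h'
    · refine single_mem ?_
      have := h1.2
      rwa [C.d_eq, h, min_eq_left (by omega)] at this
    · exact zero_mem _
    · have h3 := C.p_s_left hxy
      have h4 := C.p_s x
      have h5 := C.p_pos h1.2.1
      have h6 := C.add (C.s x) y z
      have h7 := C.lt (C.s x) z
      refine single_mem ⟨C.ne_of_p_pos (by omega), ?_⟩
      convert h1.2.2 using 1
      rw [C.d_eq, C.d_eq, C.d_eq]; omega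
    · exact zero_mem _

/-- The terms kept by `R` start either with a step of forward size at least `m`, or with the step
from `s x` to `z`, of size exactly `m`. Bidegree `(1, 1)` is excluded because there `R` yields a
single vertex, which has no first step. -/
theorem R_mem_op (hm : 3 ≤ m) {k l : ℤ} (hkl : k ≠ 1 ∨ l ≠ 1) {z : ListChain V}
    (hz : z ∈ C.FwdChains k l) :
    C.R z ∈ (C.op (by omega)).FwdChains (k - 1) (l - 1) := by
  have h0 : C.R z ∈ Finsupp.supported ℤ ℤ {w | Sq d (k - 1) (l - 1) w → (C.op (by omega)).Fwd w} := by
    refine map_mem_of_mem_supported _ _ (fun w hw => ?_) hz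
    obtain ⟨h1, h2⟩ := hw
    match w, h1, h2 with
    | [x, y], h1, h2 =>
      simp only [R, Finsupp.linearCombination_single, one_smul]
      split_ifs with h
      · refine single_mem ?_
        intro h3
        simp only [Sq] at h3
        omega
      · exact zero_mem _
    | x :: y :: z :: w, h1, h2 =>
      have hxy := C.p_pos h1.1
      have := C.p_add_swap h1.2.1
      simp only [Fwd] at h2
      simp only [R, Finsupp.linearCombination_single, one_smul]
      split_ifs with h h' h'
      · refine single_mem fun _ => ?_
        simp only [Fwd, op]; omega
      · exact zero_mem _
      · have h3 := C.p_s_left hxy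
        have h4 := C.p_s x
        have h5 := C.p_pos h1.2.1
        have h6 := C.add (C.s x) y z
        have h7 := C.lt (C.s x) z
        have h8 := C.p_add_swap (C.ne_of_p_pos (by omega : 0 < C.p (C.s x) z))
        refine single_mem fun _ => ?_
        simp only [Fwd, op]
        omega
      · exact zero_mem _
  refine mem_mono (fun w hw => ?_) (mem_inter (C.R_mem hm hz) h0)
  exact ⟨hw.1, hw.2 hw.1⟩

theorem prependPr_injective : Function.Injective C.prependPr := by
  intro a b h
  cases a <;> cases b <;> simp_all [prependPr]

theorem J_injective : Function.Injective C.J :=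
  Finsupp.mapDomain_injective C.prependPr_injective

theorem J_mem (hm : 3 ≤ m) {k l : ℤ} {z : ListChain V} (hz : z ∈ Chains d k l) :
    C.J z ∈ C.FwdChains (k + 1) (l + 1) := by
  refine map_mem_of_mem_supported _ _ (fun w hw => ?_) hz
  rw [J_single]
  refine single_mem ?_
  cases w with
  | nil => exact hw.elim
  | cons y w =>
    have h := C.p_pr y
    refine ⟨⟨C.ne_of_p_pos (by omega), ?_⟩, ?_⟩
    · convert hw using 1
      rw [C.d_eq, h, add_sub_cancel_right, min_eq_left (by omega)]
      simp
    · change C.p (C.pr y) y ≤ m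
      omega

/-- A unit forward step followed by a backward or antipodal step cannot be merged, so the old first
vertex, now interior, contributes no face. The sign is the index shift. -/
theorem D_J (hm : 3 ≤ m) {k l : ℤ} {z : ListChain V}
    (hz : z ∈ (C.op (by omega)).FwdChains k l) : D d (C.J z) = -C.J (D d z) := by
  refine map_eq_of_mem_supported (D d ∘ₗ C.J) (-(C.J ∘ₗ D d)) (fun w hw => ?_) hz
  obtain ⟨h1, h2⟩ := hw
  match w, h1, h2 with
  | x :: y :: w, h1, h2 =>
    have := C.p_pr x
    have := C.p_add_swap h1.1
    simp only [Fwd, op] at h2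
    simp only [LinearMap.comp_apply, J_single, prependPr, D_single, LinearMap.neg_apply]
    rw [listD_cons_of_ne, listD, J_cons]
    rw [Ne, C.d_add_iff (C.ne_of_p_pos (by omega)) h1.1]
    have := C.lt x y
    omega

/-- With a forward first step, merging is possible only when the total is at most `m`, so the merged
step is again forward. -/
theorem D_mem_fwd {k l : ℤ} {z : ListChain V} (hz : z ∈ C.FwdChains k l) :
    D d z ∈ C.FwdChains (k - 1) l := by
  have h0 : D d z ∈ Finsupp.supported ℤ ℤ {w | C.Fwd w} := by
    refine map_mem_of_mem_supported _ _ (fun w hw => ?_) hz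
    obtain ⟨h1, h2⟩ := hw
    match w, h1, h2 with
    | [x, y], h1, h2 => simp [listD_pair]
    | x :: y :: z :: w, h1, h2 =>
      have hxy := C.p_pos h1.1
      have hyz := C.p_pos h1.2.1
      simp only [Fwd] at h2
      rw [D_single, listD_cons]
      refine sub_mem ?_ ?_
      · split_ifs with h
        · refine single_mem ?_
          rw [C.d_add_iff h1.1 h1.2.1] at h
          have := C.add x y z
          have := C.lt y z
          simp only [Set.mem_ofPred_eq, Fwd]
          omega
        · exact zero_mem _
      · refine cons_mem (s := {t | ∃ t', t = y :: t'}) ?_ (cons_mem (s := Set.univ) ?_ (by simp))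
        · rintro _ ⟨t', rfl⟩
          exact h2
        · intro t _
          exact ⟨t, rfl⟩
  exact mem_inter (C.D_mem' (C.FwdChains_le _ _ hz)) h0

theorem eq_of_cycle (hm : 3 ≤ m) {k l : ℤ} {z : ListChain V} (hz : z ∈ C.FwdChains k l)
    (hDz : D d z = 0) : z = D d (C.splitFirst z) + C.J (C.R z) := by
  have hom := C.homotopy hm hz
  rwa [hDz, map_zero, add_zero] at hom

/-- Applying `D` to `z = D (splitFirst z) + J (R z)` leaves `J (D (R z)) = 0`, and `J` is injective.
-/
theorem D_R_eq_zero (hm : 3 ≤ m) (hDD : ∀ k l, ∀ z ∈ Chains d k l, D d (D d z) = 0)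
    {k l : ℤ} (hkl : k ≠ 1 ∨ l ≠ 1) {z : ListChain V} (hz : z ∈ C.FwdChains k l)
    (hDz : D d z = 0) : D d (C.R z) = 0 := by
  have := congrArg (D d) (C.eq_of_cycle hm hz hDz)
  rw [hDz, map_add, hDD _ _ _ (C.FwdChains_le _ _ (C.splitFirst_mem hz)), zero_add,
    C.D_J hm (C.R_mem_op hm hkl hz)] at this
  exact C.J_injective (by rw [map_zero]; exact neg_eq_zero.1 this.symm)

/-- The complex of sequences with positive or antipodal first step is acyclic off the diagonal. -/
theorem exists_D_eq_of_mem_fwd (hm : 3 ≤ m) (hDD : ∀ k l, ∀ z ∈ Chains d k l, D d (D d z) = 0)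
    (n : ℕ) (C : CyclicStep m d) {k l : ℤ} (hk : k = n)
    (hkl : l ≠ k) {z : ListChain V} (hz : z ∈ C.FwdChains k l) (hDz : D d z = 0) :
    ∃ v ∈ C.FwdChains (k + 1) l, D d v = z := by
  induction n generalizing k l z C with
  | zero =>
    refine ⟨0, zero_mem _, ?_⟩
    rw [map_zero]
    symm
    refine eq_zero_of_mem (fun w hw => ?_) hz
    obtain ⟨h1, h2⟩ := hw
    match w, h1, h2 with
    | x :: y :: w, h1, h2 =>
      have := h1.one_le
      omega
  | succ n ih =>
    have hR := C.R_mem_op hm (by omega) hz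
    have hom := C.eq_of_cycle hm hz hDz
    obtain ⟨v, hv, hDv⟩ := ih (C.op (by omega)) (k := k - 1) (l := l - 1) (by omega) (by omega) hR
      (C.D_R_eq_zero hm hDD (by omega) hz hDz)
    -- Since `R z = D v` and `D` anticommutes with `J` on `v`, the defect `J (R z)` equals `-D (J
    -- v)`.
    refine ⟨C.splitFirst z - C.J v, sub_mem (C.splitFirst_mem hz) ?_, ?_⟩
    · have := C.J_mem hm ((C.op (by omega)).FwdChains_le _ _ hv)
      rwa [show k - 1 + 1 + 1 = k + 1 by ring, sub_add_cancel] at this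
    · rw [map_sub, C.D_J hm hv, hDv, sub_neg_eq_add]
      exact hom.symm

end CyclicStep

/-! ### Free homology at the level of sequences -/

namespace ListChain

variable {V : Type}

/-- The homology of the deletion differential in bidegree `(k, l)` is free of rank `n`. -/
def HasFreeHomology (d : V → V → ℕ) (k l : ℤ) (n : ℕ) : Prop :=
  ∃ (ι : Type) (_ : Fintype ι) (φ : ListChain V →ₗ[ℤ] (ι → ℤ)), Fintype.card ι = n ∧
    (∀ y ∈ Chains d (k + 1) l, φ (D d y) = 0) ∧
    (∀ z ∈ Chains d k l, D d z = 0 → φ z = 0 → ∃ y ∈ Chains d (k + 1) l, D d y = z) ∧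
    ∀ v, ∃ z ∈ Chains d k l, D d z = 0 ∧ φ z = v

theorem hasFreeHomology_zero (d : V → V → ℕ) {k l : ℤ} (h : ∀ w, ¬ Sq d k l w) :
    HasFreeHomology d k l 0 := by
  refine ⟨Fin 0, inferInstance, 0, rfl, fun _ _ => rfl, fun z hz _ _ => ⟨0, zero_mem _, ?_⟩,
    fun v => ⟨0, zero_mem _, map_zero _, Subsingleton.elim _ _⟩⟩
  rw [map_zero, eq_zero_of_mem h hz]

/-- A criterion for free homology when there are no boundaries. -/
theorem hasFreeHomology_of_cycles (d : V → V → ℕ) {k l : ℤ} (hkl : ∀ w, ¬ Sq d (k + 1) l w)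
    {ι : Type} [Fintype ι] (f : ι → List V) (hf : Function.Injective f)
    (hs : ∀ i, Sq d k l (f i)) (hD : ∀ i, listD d (f i) = 0)
    (h : ∀ z ∈ Chains d k l, D d z = 0 → z ∈ Finsupp.supported ℤ ℤ (Set.range f)) :
    HasFreeHomology d k l (Fintype.card ι) := by
  classical
  refine ⟨ι, inferInstance, LinearMap.pi fun i => Finsupp.lapply (f i), rfl, ?_, ?_, ?_⟩
  · intro y hy
    rw [eq_zero_of_mem hkl hy, map_zero, map_zero]
  · intro z hz hDz hφ
    refine ⟨0, zero_mem _, ?_⟩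
    rw [map_zero]
    symm
    ext w
    by_cases hw : w ∈ Set.range f
    · obtain ⟨i, rfl⟩ := hw
      exact congrFun hφ i
    · exact (Finsupp.mem_supported' _ _).1 (h z hz hDz) w hw
  · intro v
    refine ⟨∑ i, v i • Finsupp.single (f i) 1,
      sum_mem fun i _ => Submodule.smul_mem _ _ (single_mem (hs i)), ?_, ?_⟩
    · simp only [map_sum, map_smul, D_single, hD, smul_zero, Finset.sum_const_zero]
    · ext j
      simp [Finsupp.single_apply, hf.eq_iff]

end ListChain

/-! ### Mayer–Vietoris for the forward and backward subcomplexes -/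

namespace CyclicStep

open ListChain

variable {V : Type} {m : ℕ} {d : V → V → ℕ} (C : CyclicStep m d)

/-- Prepends to a sequence the antipode of its first entry. -/
def prependAnt : List V → List V
  | y :: w => C.ant y :: y :: w
  | [] => []

/-- The linear extension of `prependAnt`. -/
noncomputable def M : ListChain V →ₗ[ℤ] ListChain V := Finsupp.lmapDomain ℤ ℤ C.prependAnt

/-- Removes the first entry if the first step is antipodal. -/
noncomputable def strip : ListChain V →ₗ[ℤ] ListChain V :=
  Finsupp.linearCombination ℤ fun
    | x :: y :: w => if C.p x y = m then Finsupp.single (y :: w) 1 else 0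
    | _ => 0

open Classical in
/-- The projection onto the sequences with positive or antipodal first step. -/
noncomputable def fwdPart : ListChain V →ₗ[ℤ] ListChain V :=
  Finsupp.linearCombination ℤ fun w => if C.Fwd w then Finsupp.single w 1 else 0

@[simp] theorem M_single (w : List V) (n : ℤ) :
    C.M (Finsupp.single w n) = Finsupp.single (C.prependAnt w) n := by simp [M]

theorem M_cons (x : V) (u : ListChain V) : C.M (cons x u) = cons (C.ant x) (cons x u) := by
  have : C.M ∘ₗ cons x = cons (C.ant x) ∘ₗ cons x := by
    ext w : 2
    simp [prependAnt]
  exact LinearMap.congr_fun this u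

theorem M_injective : Function.Injective C.M := by
  refine Finsupp.mapDomain_injective fun a b h => ?_
  cases a <;> cases b <;> simp_all [prependAnt]

theorem M_mem (hm : 3 ≤ m) {k l : ℤ} {z : ListChain V} (hz : z ∈ Chains d k l) :
    C.M z ∈ C.FwdChains (k + 1) (l + m) ∧
      C.M z ∈ (C.op (by omega)).FwdChains (k + 1) (l + m) := by
  have : C.M z ∈ Finsupp.supported ℤ ℤ {w | Sq d (k + 1) (l + m) w ∧ C.Fwd w ∧
      (C.op (by omega)).Fwd w} := by
    refine map_mem_of_mem_supported _ _ (fun w hw => ?_) hz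
    rw [M_single]
    refine single_mem ?_
    cases w with
    | nil => exact hw.elim
    | cons y w =>
      have h := C.p_ant' (by omega) y
      have h' := C.p_ant y
      refine ⟨⟨C.ne_of_p_pos (by omega : 0 < C.p (C.ant y) y), ?_⟩, ?_, ?_⟩
      · convert hw using 1
        rw [C.d_eq, h, add_sub_cancel_right, min_eq_left (by omega)]
        simp
      · exact h.le
      · exact h'.le
  constructor
  · exact Finsupp.supported_mono (fun w hw => And.intro hw.1 hw.2.1) this
  · exact Finsupp.supported_mono (fun w hw => And.intro hw.1 hw.2.2) this

/-- An antipodal step merges with nothing, so prefixing one creates no new face and only shifts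
signs. -/
theorem D_M (hm : 3 ≤ m) {k l : ℤ} {z : ListChain V} (hz : z ∈ Chains d k l) :
    D d (C.M z) = -C.M (D d z) := by
  refine map_eq_of_mem_supported (D d ∘ₗ C.M) (-(C.M ∘ₗ D d)) (fun w hw => ?_) hz
  simp only [LinearMap.comp_apply, M_single, D_single, LinearMap.neg_apply]
  match w, hw with
  | [x], _ => simp [prependAnt, listD, tailD]
  | x :: y :: w, hw =>
    have := C.p_ant' (by omega) x
    have := C.p_pos hw.1
    have := C.lt x y
    rw [prependAnt, listD_cons_of_ne, listD, M_cons]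
    rw [Ne, C.d_add_iff (C.ne_of_p_pos (by omega)) hw.1]
    omega

theorem strip_M (hm : 3 ≤ m) {k l : ℤ} {z : ListChain V} (hz : z ∈ Chains d k l) :
    C.strip (C.M z) = z := by
  refine map_eq_of_mem_supported (C.strip ∘ₗ C.M) LinearMap.id (fun w hw => ?_) hz
  simp only [LinearMap.comp_apply, M_single, LinearMap.id_apply]
  cases w with
  | nil => exact hw.elim
  | cons y w => simp [strip, prependAnt, C.p_ant' (by omega)]

theorem p_eq_of_fwd (hm : 0 < m) {x y : V} {w : List V} (hxy : x ≠ y) (h : C.Fwd (x :: y :: w))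
    (h' : (C.op hm).Fwd (x :: y :: w)) : C.p x y = m := by
  have := C.p_add_swap hxy
  simp only [Fwd, op] at h h'
  omega

theorem sq_tail (hm : 0 < m) {k l : ℤ} {x y : V} {w : List V} (h : Sq d k l (x :: y :: w))
    (hp : C.p x y = m) : Sq d (k - 1) (l - m) (y :: w) := by
  have := h.2
  rwa [C.d_eq, hp, min_eq_left (by omega)] at this

/-- A first step of size at most `m` in both directions is antipodal, so its source is determined by
its target and can be dropped without loss. -/
theorem M_strip (hm : 3 ≤ m) {k l : ℤ} {z : ListChain V} (hz : z ∈ C.FwdChains k l)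
    (hz' : z ∈ (C.op (by omega)).FwdChains k l) :
    C.M (C.strip z) = z ∧ C.strip z ∈ Chains d (k - 1) (l - m) := by
  have h := mem_inter hz hz'
  constructor
  · refine map_eq_of_mem_supported (C.M ∘ₗ C.strip) LinearMap.id (fun w hw => ?_) h
    obtain ⟨⟨h1, h2⟩, -, h3⟩ := hw
    match w, h1, h2, h3 with
    | x :: y :: w, h1, h2, h3 =>
      have h4 := C.p_eq_of_fwd _ h1.1 h2 h3
      have h5 : C.ant y = x := by
        refine ((C.op (by omega)).eq_of_p_eq (x := y) ?_)
        exact (C.p_ant' (by omega) y).trans h4.symm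
      simp [strip, prependAnt, h4, h5]
  · refine map_mem_of_mem_supported _ _ (fun w hw => ?_) h
    obtain ⟨⟨h1, h2⟩, -, h3⟩ := hw
    match w, h1, h2, h3 with
    | x :: y :: w, h1, h2, h3 =>
      have h4 := C.p_eq_of_fwd _ h1.1 h2 h3
      simp only [strip, Finsupp.linearCombination_single, one_smul, if_pos h4]
      exact single_mem (C.sq_tail (by omega) h1 h4)

theorem fwdPart_of_mem {k l : ℤ} {z : ListChain V} (hz : z ∈ C.FwdChains k l) :
    C.fwdPart z = z :=
  map_eq_of_mem_supported C.fwdPart LinearMap.id (fun w hw => by simp [fwdPart, hw.2]) hz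

theorem fwdPart_mem {k l : ℤ} {z : ListChain V} (hz : z ∈ Chains d k l) :
    C.fwdPart z ∈ C.FwdChains k l := by
  refine map_mem_of_mem_supported _ _ (fun w hw => ?_) hz
  simp only [fwdPart, Finsupp.linearCombination_single, one_smul]
  split_ifs with h
  · exact single_mem ⟨hw, h⟩
  · exact zero_mem _

theorem fwdPart_mem_op (hm : 0 < m) {k l : ℤ} {z : ListChain V}
    (hz : z ∈ (C.op hm).FwdChains k l) : C.fwdPart z ∈ (C.op hm).FwdChains k l := by
  refine map_mem_of_mem_supported _ _ (fun w hw => ?_) hz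
  simp only [fwdPart, Finsupp.linearCombination_single, one_smul]
  split_ifs with h
  · exact single_mem hw
  · exact zero_mem _

/-- What is not forward must be backward, provided there is a first step at all; this is where
degree `0` is excluded. -/
theorem sub_fwdPart_mem (hm : 0 < m) {k l : ℤ} (hk : k ≠ 0) {z : ListChain V}
    (hz : z ∈ Chains d k l) : z - C.fwdPart z ∈ (C.op hm).FwdChains k l := by
  refine map_mem_of_mem_supported (LinearMap.id - C.fwdPart) _ (fun w hw => ?_) hz
  simp only [LinearMap.sub_apply, LinearMap.id_apply, fwdPart, Finsupp.linearCombination_single,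
    one_smul]
  split_ifs with h
  · simp
  · rw [sub_zero]
    refine single_mem ⟨hw, ?_⟩
    match w, hw, h with
    | [x], hw, h => exact absurd hw.1 hk
    | x :: y :: w, hw, h =>
      have := C.p_add_swap hw.1
      simp only [Fwd, op] at h ⊢
      omega

/-- The Mayer–Vietoris step: off the diagonal, the homology in bidegree `(k, l)` is the homology in
bidegree `(k - 2, l - m)`. -/
theorem hasFreeHomology_step (C : CyclicStep m d) (hm : 3 ≤ m)
    (hDD : ∀ k l, ∀ z ∈ Chains d k l, D d (D d z) = 0)
    {k l : ℤ} (hk : 1 ≤ k) (hkl : l ≠ k) {n : ℕ} (h : HasFreeHomology d (k - 2) (l - m) n) :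
    HasFreeHomology d k l n := by
  obtain ⟨ι, hι, φ, hn, h1, h2, h3⟩ := h
  have hm0 : 0 < m := by omega
  rw [show k - 2 + 1 = k - 1 by ring] at h1 h2
  have acyc := fun (C : CyclicStep m d) {k l : ℤ} (hk : 0 ≤ k) (hkl : l ≠ k) {z : ListChain V} =>
    exists_D_eq_of_mem_fwd hm hDD k.toNat C (k := k) (l := l) (by omega) hkl (z := z)
  -- This is the connecting map: the boundary of the forward part of a cycle lies in the antipodal
  -- intersection, where the first vertex is stripped.
  refine ⟨ι, hι, φ ∘ₗ C.strip ∘ₗ D d ∘ₗ C.fwdPart, hn, ?_, ?_, ?_⟩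
  · intro y hy
    simp only [LinearMap.comp_apply]
    have ha := C.fwdPart_mem hy
    have hb := C.sub_fwdPart_mem hm0 (by omega) hy
    have hDa := C.D_mem_fwd ha
    have hDb := (C.op hm0).D_mem_fwd hb
    -- The forward part of a backward chain lies in the intersection, hence is `M` of some chain;
    -- its boundary then strips to a boundary, which `φ` kills.
    have hE1 := C.fwdPart_mem ((C.op hm0).FwdChains_le _ _ hDb)
    have hE2 := C.fwdPart_mem_op hm0 hDb
    rw [add_sub_cancel_right] at hDa hE1 hE2
    obtain ⟨he, he'⟩ := C.M_strip hm hE1 hE2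
    have hy' : D d y = D d (C.fwdPart y) + D d (y - C.fwdPart y) := by
      rw [← map_add, add_sub_cancel]
    rw [hy', map_add, C.fwdPart_of_mem hDa, map_add, hDD _ _ _ (C.FwdChains_le _ _ ha), zero_add,
      ← he, C.D_M hm he', map_neg, C.strip_M hm (C.D_mem' he'), map_neg, h1 _ he', neg_zero]
  · intro z hz hDz hφ
    simp only [LinearMap.comp_apply] at hφ
    have ha := C.fwdPart_mem hz
    have hb := C.sub_fwdPart_mem hm0 (by omega) hz
    set a := C.fwdPart z
    have hab : D d a = -D d (z - a) := by rw [map_sub, hDz]; simp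
    have hDa := C.D_mem_fwd ha
    have hDa' : D d a ∈ (C.op hm0).FwdChains (k - 1) l := by
      rw [hab]
      exact neg_mem ((C.op hm0).D_mem_fwd hb)
    obtain ⟨he, he'⟩ := C.M_strip hm hDa hDa'
    have hDe : D d (C.strip (D d a)) = 0 := by
      have h4 := C.D_M hm he'
      rw [he, hDD _ _ _ (C.FwdChains_le _ _ ha)] at h4
      exact C.M_injective (by rw [map_zero]; exact neg_eq_zero.1 h4.symm)
    rw [show k - 1 - 1 = k - 2 by ring] at he'
    obtain ⟨f, hf, hDf⟩ := h2 _ he' hDe hφ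
    obtain ⟨hMf, hMf'⟩ := C.M_mem hm hf
    rw [sub_add_cancel, sub_add_cancel] at hMf hMf'
    -- Adding `M f` to the forward part and subtracting it from the rest turns both into cycles,
    -- each bounding in its own half.
    have hDM : D d (C.M f) = -D d a := by rw [C.D_M hm hf, hDf, he]
    obtain ⟨u, hu, hDu⟩ := acyc C (by omega) hkl (add_mem ha hMf) (by rw [map_add, hDM]; simp)
    obtain ⟨v, hv, hDv⟩ := acyc (C.op hm0) (by omega) hkl (sub_mem hb hMf')
      (by rw [map_sub, hDM, map_sub, hDz]; simp)
    refine ⟨u + v, add_mem (C.FwdChains_le _ _ hu) ((C.op hm0).FwdChains_le _ _ hv), ?_⟩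
    rw [map_add, hDu, hDv]
    abel
  · intro v
    obtain ⟨e, he, hDe, hv⟩ := h3 v
    obtain ⟨hMe, hMe'⟩ := C.M_mem hm he
    rw [sub_add_cancel, show k - 2 + 1 = k - 1 by ring] at hMe hMe'
    -- The cycle `M e` has degree `k - 1`, so acyclicity fails only on this line; there `l - m < k -
    -- 2` and no chains `e` exist except zero.
    by_cases hkl' : l = k - 1
    · refine ⟨0, zero_mem _, map_zero _, ?_⟩
      rw [map_zero, ← hv, eq_zero_of_mem (fun w hw => ?_) he, map_zero]
      have := Sq.le d C.d_pos hw
      omega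
    have hDM : D d (C.M e) = 0 := by rw [C.D_M hm he, hDe]; simp
    obtain ⟨a, ha, hDa⟩ := acyc C (by omega) hkl' hMe hDM
    obtain ⟨b, hb, hDb⟩ := acyc (C.op hm0) (by omega) hkl' hMe' hDM
    rw [sub_add_cancel] at ha hb
    -- Two fillings of `M e`, one in each half, differ by a cycle whose connecting image is the
    -- class of `e`.
    refine ⟨a - b, sub_mem (C.FwdChains_le _ _ ha) ((C.op hm0).FwdChains_le _ _ hb), ?_, ?_⟩
    · rw [map_sub, hDa, hDb, sub_self]
    · simp only [LinearMap.comp_apply]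
      obtain ⟨hg, hg'⟩ := C.M_strip hm (C.fwdPart_mem ((C.op hm0).FwdChains_le _ _ hb))
        (C.fwdPart_mem_op hm0 hb)
      rw [map_sub, C.fwdPart_of_mem ha, map_sub, hDa, map_sub, C.strip_M hm he, map_sub, hv, ← hg,
        C.D_M hm hg', map_neg, C.strip_M hm (C.D_mem' hg'), map_neg, h1 _ hg', neg_zero, sub_zero]

/-! ### The diagonal and the origin -/

/-- The sequence of `n` steps of size one with alternating directions before a given sequence. -/
def alternating (hm : 0 < m) : ℕ → CyclicStep m d → List V → List V
  | 0, _, w => w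
  | n + 1, C, w => C.prependPr (alternating hm n (C.op hm) w)

theorem alternating_injective (hm : 0 < m) (n : ℕ) (C : CyclicStep m d) :
    Function.Injective (alternating hm n C) := by
  induction n generalizing C with
  | zero => exact fun _ _ h => h
  | succ n ih => exact C.prependPr_injective.comp (ih (C.op hm))

theorem alternating_mem (hm : 3 ≤ m) (n : ℕ) (C : CyclicStep m d) (x : V) :
    (Finsupp.single (alternating (by omega) (n + 1) C [x]) 1 : ListChain V) ∈
      C.FwdChains (n + 1) (n + 1) ∧ listD d (alternating (by omega) (n + 1) C [x]) = 0 := by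
  induction n generalizing C with
  | zero =>
    refine ⟨?_, listD_pair _ _ _⟩
    rw [alternating, ← J_single]
    exact C.J_mem hm (single_mem ⟨by simp, by simp⟩)
  | succ n ih =>
    obtain ⟨h1, h2⟩ := ih (C.op (by omega))
    rw [alternating, ← J_single, ← D_single, ← J_single, C.D_J hm h1, D_single, h2]
    refine ⟨?_, by simp⟩
    push_cast
    exact C.J_mem hm ((C.op _).FwdChains_le _ _ h1)

/-- On the diagonal splitting would give more steps than the length allows, so `splitFirst` vanishes
and `z = J (R z)`. Iterating with alternating directions peels off all the steps. -/
theorem exists_alternating (hm : 3 ≤ m) (hDD : ∀ k l, ∀ z ∈ Chains d k l, D d (D d z) = 0)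
    (n : ℕ) (C : CyclicStep m d) {z : ListChain V} (hz : z ∈ C.FwdChains (n + 1) (n + 1))
    (hDz : D d z = 0) : ∃ u ∈ Chains d 0 0,
      z = Finsupp.lmapDomain ℤ ℤ (alternating (by omega) (n + 1) C) u := by
  have h0 : C.splitFirst z = 0 := by
    refine eq_zero_of_mem (fun w hw => ?_) (C.splitFirst_mem hz)
    have := Sq.le d C.d_pos hw.1
    omega
  have hz' := C.eq_of_cycle hm hz hDz
  rw [h0, map_zero, zero_add] at hz'
  induction n generalizing C z with
  | zero =>
    refine ⟨C.R z, by simpa using C.R_mem hm hz, hz'⟩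
  | succ n ih =>
    have hR := C.R_mem_op hm (by left; push_cast; omega) hz
    rw [add_sub_cancel_right] at hR
    push_cast at hR
    have hDR := C.D_R_eq_zero hm hDD (by left; push_cast; omega) hz hDz
    have h0' : (C.op (by omega)).splitFirst (C.R z) = 0 := by
      refine eq_zero_of_mem (fun w hw => ?_) ((C.op (by omega)).splitFirst_mem hR)
      have := Sq.le d C.d_pos hw.1
      omega
    have hz'' := (C.op (by omega)).eq_of_cycle hm hR hDR
    rw [h0', map_zero, zero_add] at hz''
    obtain ⟨u, hu, hRu⟩ := ih (C.op (by omega)) hR hDR h0' hz''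
    refine ⟨u, hu, ?_⟩
    rw [hz', hRu, J, ← LinearMap.comp_apply, ← Finsupp.lmapDomain_comp]
    rfl

theorem le_of_sq_fwd (hm : 3 ≤ m) {k l : ℤ} {w : List V} (h : Sq d k l w) (h1 : C.Fwd w)
    (h2 : (C.op (by omega)).Fwd w) : k - 1 ≤ l - m := by
  match w, h, h1, h2 with
  | x :: y :: w, h, h1, h2 =>
    exact Sq.le d C.d_pos (C.sq_tail (by omega) h (C.p_eq_of_fwd _ h.1 h1 h2))

theorem hasFreeHomology_diag [Fintype V] (C : CyclicStep m d) (hm : 3 ≤ m)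
    (hDD : ∀ k l, ∀ z ∈ Chains d k l, D d (D d z) = 0) (n : ℕ) :
    HasFreeHomology d (n + 1) (n + 1) (Fintype.card V + Fintype.card V) := by
  have hm0 : 0 < m := by omega
  have hsq : ∀ (C : CyclicStep m d) x, Sq d (n + 1) (n + 1) (alternating hm0 (n + 1) C [x]) ∧
      C.Fwd (alternating hm0 (n + 1) C [x]) := fun C x => by
    have := (alternating_mem hm n C x).1
    rw [Finsupp.mem_supported] at this
    exact this (by simp)
  rw [← Fintype.card_sum]
  refine hasFreeHomology_of_cycles d (fun w hw => ?_)
    (Sum.elim (fun x => alternating hm0 (n + 1) C [x])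
      (fun x => alternating hm0 (n + 1) (C.op hm0) [x])) ?_ ?_ ?_ ?_
  · have := Sq.le d C.d_pos hw
    omega
  · refine Function.Injective.sumElim ?_ ?_ ?_
    · exact (alternating_injective hm0 _ C).comp fun _ _ h => by simpa using h
    · exact (alternating_injective hm0 _ _).comp fun _ _ h => by simpa using h
    -- A common value of the two families would have an antipodal first step, too long for a
    -- sequence made of unit steps.
    · intro x y h
      have h1 := hsq C x
      have h2 := (hsq (C.op hm0) y).2
      rw [← h] at h2
      have := C.le_of_sq_fwd hm h1.1 h1.2 h2
      omega
  · rintro (x | x)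
    · exact (hsq C x).1
    · exact (hsq _ x).1
  · rintro (x | x)
    · exact (alternating_mem hm n C x).2
    · exact (alternating_mem hm n _ x).2
  · intro z hz hDz
    have key : ∀ (C : CyclicStep m d) (s : Set (List V)),
        (∀ x, alternating hm0 (n + 1) C [x] ∈ s) → ∀ z ∈ C.FwdChains (n + 1) (n + 1), D d z = 0 →
          z ∈ Finsupp.supported ℤ ℤ s := by
      intro C s hs z hz hDz
      obtain ⟨u, hu, rfl⟩ := exists_alternating hm hDD n C hz hDz
      refine map_mem_of_mem_supported _ _ (fun w hw => ?_) hu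
      match w, hw with
      | [x], _ => simpa using single_mem (hs x)
      | x :: y :: w, hw =>
        have := hw.one_le
        omega
    have ha := C.fwdPart_mem hz
    have hb := C.sub_fwdPart_mem hm0 (by omega) hz
    have hab : D d (C.fwdPart z) = -D d (z - C.fwdPart z) := by rw [map_sub, hDz]; simp
    have hDa : D d (C.fwdPart z) = 0 := by
      have h1 := C.D_mem_fwd ha
      have h2 := (C.op hm0).D_mem_fwd hb
      rw [← neg_mem_iff, ← hab] at h2
      -- An antipodal first step in bidegree `(n, n + 1)` forces `n - 1 ≤ n + 1 - m`, that is `m ≤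
      -- 2`; here `m ≥ 3` is essential. So the forward and backward parts are separately cycles.
      refine eq_zero_of_mem (fun w hw => ?_) (mem_inter h1 h2)
      have := C.le_of_sq_fwd hm hw.1.1 hw.1.2 hw.2.2
      omega
    rw [← add_sub_cancel (C.fwdPart z) z]
    refine add_mem (key C _ (fun x => ?_) _ ha hDa)
      (key (C.op hm0) _ (fun x => ?_) _ hb (by rw [map_sub, hDz, hDa, sub_zero]))
    · exact ⟨Sum.inl x, rfl⟩
    · exact ⟨Sum.inr x, rfl⟩

theorem hasFreeHomology_origin [Fintype V] (C : CyclicStep m d) :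
    HasFreeHomology d 0 0 (Fintype.card V) := by
  refine hasFreeHomology_of_cycles d (fun w hw => ?_) (fun x => [x])
    (fun _ _ h => by simpa using h) (fun x => ⟨rfl, rfl⟩) (fun x => by simp [listD, tailD]) ?_
  · have := Sq.le d C.d_pos hw
    omega
  · intro z hz _
    refine mem_mono (fun w hw => ?_) hz
    match w, hw with
    | [x], _ => exact ⟨x, rfl⟩
    | x :: y :: w, hw =>
      have := hw.one_le
      omega

end CyclicStep

open ListChain

/-! ### Comparison with the magnitude complex -/

namespace SimpleGraph

variable {V : Type} (G : SimpleGraph V) {d : V → V → ℕ}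

theorem isMagnitudeSeq_iff (hG : ∀ x y, G.edist x y = d x y) {k l : ℤ} {w : List V} :
    G.IsMagnitudeSeq k l w ↔ Sq d k l w := by
  induction w generalizing k l with
  | nil => simp [IsMagnitudeSeq, Sq]
  | cons x w ih =>
    cases w with
    | nil =>
      simp only [IsMagnitudeSeq, Sq, seqLength]
      constructor
      · rintro ⟨-, h, -, n, h1, h2⟩
        have : n = 0 := by exact_mod_cast h2.symm
        simp at h
        omega
      · rintro ⟨rfl, rfl⟩
        exact ⟨by simp, by simp, by simp, 0, by simp, by simp⟩
    | cons y w =>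
      rw [Sq, ← ih]
      simp only [IsMagnitudeSeq, seqLength, hG, List.isChain_cons_cons, List.length_cons]
      constructor
      · rintro ⟨-, h, ⟨hxy, hc⟩, n, h1, h2⟩
        refine ⟨hxy, by simp, by push_cast at h ⊢; omega, hc, ?_⟩
        have hfin : G.seqLength (y :: w) ≠ ⊤ := by
          intro h3
          rw [h3] at h2
          simp at h2
        lift G.seqLength (y :: w) to ℕ using hfin with r
        refine ⟨r, ?_, rfl⟩
        have : d x y + r = n := by exact_mod_cast h2
        omega
      · rintro ⟨hxy, -, h, hc, n, h1, h2⟩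
        refine ⟨by simp, by push_cast at h ⊢; omega, ⟨hxy, hc⟩, d x y + n, by push_cast; omega, ?_⟩
        rw [h2]
        simp

open Classical in
/-- The basis element of a sequence of bidegree `(k, l)`, and `0` for any other sequence. -/
noncomputable def seqSingle (d : V → V → ℕ) (k l : ℤ) (w : List V) : ListChain V :=
  if Sq d k l w then Finsupp.single w 1 else 0

theorem seqSingle_pos {k l : ℤ} {w : List V} (h : Sq d k l w) :
    seqSingle d k l w = Finsupp.single w 1 := if_pos h

theorem seqSingle_neg {k l : ℤ} {w : List V} (h : ¬ Sq d k l w) : seqSingle d k l w = 0 := if_neg h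

/-- The recursion gives the first interior deletion sign `+1` where the magnitude differential has
`(-1) ^ 1`. The global sign does not affect cycles or boundaries. -/
theorem sum_eraseIdx_eq (hd : ∀ x y, x ≠ y → 0 < d x y) (hd0 : ∀ x, d x x = 0) {k l : ℤ}
    {w : List V} (hw : Sq d k l w) :
    ∑ a ∈ Finset.Ico 1 (w.length - 1), (-1 : ℤ) ^ a • seqSingle d (k - 1) l (w.eraseIdx a) =
      -listD d w := by
  induction w generalizing k l with
  | nil => exact hw.elim
  | cons x w ih =>
    rcases w with _ | ⟨y, _ | ⟨z, w⟩⟩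
    · simp [listD, tailD]
    · simp [listD_pair]
    · rw [listD_cons, show (x :: y :: z :: w).length - 1 = (y :: z :: w).length - 1 + 1 by simp,
        Finset.sum_eq_sum_Ico_succ_bot (by simp), ← Finset.sum_Ico_add' _ 1 _ 1]
      have hsum : ∑ a ∈ Finset.Ico 1 ((y :: z :: w).length - 1), (-1 : ℤ) ^ (a + 1) •
          seqSingle d (k - 1) l ((x :: y :: z :: w).eraseIdx (a + 1)) =
          -cons x (-listD d (y :: z :: w)) := by
        rw [← ih hw.2, map_sum, ← Finset.sum_neg_distrib]
        refine Finset.sum_congr rfl fun a ha => ?_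
        obtain ⟨b, rfl⟩ : ∃ b, a = b + 1 := ⟨a - 1, by rw [Finset.mem_Ico] at ha; omega⟩
        simp only [List.eraseIdx_cons_succ]
        have : Sq d (k - 1) l (x :: y :: (z :: w).eraseIdx b) ↔
            Sq d (k - 1 - 1) (l - d x y) (y :: (z :: w).eraseIdx b) :=
          ⟨fun h => h.2, fun h => ⟨hw.1, h⟩⟩
        rw [pow_succ, mul_neg_one, neg_smul, map_smul]
        by_cases h : Sq d (k - 1 - 1) (l - d x y) (y :: (z :: w).eraseIdx b)
        · rw [seqSingle_pos h, seqSingle_pos (this.2 h), cons_single]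
        · rw [seqSingle_neg h, seqSingle_neg (mt this.1 h), map_zero]
      have hfirst : Sq d (k - 1) l (x :: z :: w) ↔ d x z = d x y + d y z := by
        constructor
        · rintro ⟨-, h⟩
          have h2 := hw.2.2
          have key : ∀ {w : List V} {z : V} {k l l' : ℤ}, Sq d k l (z :: w) → Sq d k l' (z :: w) →
              l = l' := by
            intro w
            induction w with
            | nil => intro z k l l' h h'; exact h.2.trans h'.2.symm
            | cons y w ih => intro z k l l' h h'; have := ih h.2 h'.2; omega
          have := key h h2
          omega
        · intro h
          refine ⟨?_, ?_⟩
          · rintro rfl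
            have := hd x y hw.1
            rw [hd0] at h
            omega
          · have h2 := hw.2.2
            rwa [sub_sub l, ← Nat.cast_add, ← h] at h2
      rw [hsum, listD]
      simp only [List.eraseIdx_cons_succ, List.eraseIdx_cons_zero, seqSingle, hfirst]
      rw [map_neg, neg_neg, pow_one, neg_one_smul, neg_sub]
      abel

/-- The inclusion of a magnitude chain group in the group of all chains of sequences. -/
noncomputable def magnitudeIncl (k l : ℤ) : G.MagnitudeChain k l →ₗ[ℤ] ListChain V :=
  Finsupp.lmapDomain ℤ ℤ Subtype.val

theorem magnitudeIncl_injective (k l : ℤ) : Function.Injective (G.magnitudeIncl k l) :=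
  Finsupp.mapDomain_injective Subtype.val_injective

theorem magnitudeIncl_mem (hG : ∀ x y, G.edist x y = d x y) {k l : ℤ} (z : G.MagnitudeChain k l) :
    G.magnitudeIncl k l z ∈ Chains d k l := by
  induction z using Finsupp.induction_linear with
  | zero => simp
  | add f g hf hg => rw [map_add]; exact add_mem hf hg
  | single w n =>
    simp only [magnitudeIncl, Finsupp.lmapDomain_apply, Finsupp.mapDomain_single]
    exact Finsupp.single_mem_supported ℤ n ((G.isMagnitudeSeq_iff hG).1 w.2)

theorem exists_magnitudeIncl_eq (hG : ∀ x y, G.edist x y = d x y) {k l : ℤ} {z : ListChain V}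
    (hz : z ∈ Chains d k l) : ∃ z', G.magnitudeIncl k l z' = z := by
  refine map_mem_of_mem_supported LinearMap.id (LinearMap.range (G.magnitudeIncl k l))
    (fun w hw => ?_) hz
  exact ⟨Finsupp.single ⟨w, (G.isMagnitudeSeq_iff hG).2 hw⟩ 1, by simp [magnitudeIncl]⟩

theorem magnitudeIncl_magnitudeD (hG : ∀ x y, G.edist x y = d x y)
    (hd : ∀ x y, x ≠ y → 0 < d x y) (hd0 : ∀ x, d x x = 0) {k j l : ℤ} (hj : j = k - 1)
    (z : G.MagnitudeChain k l) :
    G.magnitudeIncl j l (G.magnitudeD l k j z) = -D d (G.magnitudeIncl k l z) := by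
  classical
  subst hj
  suffices G.magnitudeIncl (k - 1) l ∘ₗ G.magnitudeD l k (k - 1) = -(D d ∘ₗ G.magnitudeIncl k l) from
    LinearMap.congr_fun this z
  refine Finsupp.lhom_ext' fun x => LinearMap.ext_ring ?_
  simp only [LinearMap.comp_apply, Finsupp.lsingle_apply, LinearMap.neg_apply, magnitudeD_single]
  have h1 : G.magnitudeIncl k l (Finsupp.single x 1) = Finsupp.single x.1 1 := by
    simp [magnitudeIncl]
  rw [h1, D_single, ← sum_eraseIdx_eq hd hd0 ((G.isMagnitudeSeq_iff hG).1 x.2), map_sum]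
  refine Finset.sum_congr rfl fun a _ => ?_
  rw [map_smul, magnitudeSingle]
  by_cases h : G.IsMagnitudeSeq (k - 1) l (x.1.eraseIdx a)
  · rw [dif_pos h, seqSingle_pos ((G.isMagnitudeSeq_iff hG).1 h)]
    simp [magnitudeIncl]
  · rw [dif_neg h, seqSingle_neg (mt (G.isMagnitudeSeq_iff hG).2 h), map_zero]

/-- Transported from `magnitudeD_comp` through the injective inclusion; the two signs cancel. -/
theorem D_D_eq_zero (hG : ∀ x y, G.edist x y = d x y) (hd : ∀ x y, x ≠ y → 0 < d x y)
    (hd0 : ∀ x, d x x = 0) (k l : ℤ) (z : ListChain V) (hz : z ∈ Chains d k l) :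
    D d (D d z) = 0 := by
  obtain ⟨z, rfl⟩ := G.exists_magnitudeIncl_eq hG hz
  have h1 := G.magnitudeIncl_magnitudeD hG hd hd0 rfl z
  have h2 := G.magnitudeIncl_magnitudeD hG hd hd0 rfl (G.magnitudeD l k (k - 1) z)
  have h3 := LinearMap.congr_fun (G.magnitudeD_comp l k) z
  simp only [LinearMap.comp_apply, LinearMap.zero_apply] at h3
  rw [h3, h1, map_zero, map_neg, neg_neg] at h2
  exact h2.symm

theorem nonempty_homology_equiv {R : Type} [Ring R]
    (S : CategoryTheory.ShortComplex (ModuleCat.{0} R)) {F : Type} [AddCommGroup F] [Module R F]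
    (ψ : LinearMap.ker S.g.hom →ₗ[R] F) (hψ : Function.Surjective ψ)
    (hker : LinearMap.range S.moduleCatToCycles = LinearMap.ker ψ) :
    Nonempty (S.homology ≃ₗ[R] F) :=
  ⟨S.moduleCatHomologyIso.toLinearEquiv.trans
    (LinearEquiv.trans (M₂ := LinearMap.ker S.g.hom ⧸ LinearMap.ker ψ)
      (Submodule.quotEquivOfEq _ _ hker) (ψ.quotKerEquivOfSurjective hψ))⟩

theorem exists_magnitudeHomology_equiv (hG : ∀ x y, G.edist x y = d x y)
    (hd : ∀ x y, x ≠ y → 0 < d x y) (hd0 : ∀ x, d x x = 0) {k l : ℤ} {n : ℕ}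
    (h : HasFreeHomology d k l n) :
    ∃ (ι : Type) (_ : Fintype ι), Fintype.card ι = n ∧
      Nonempty (G.magnitudeHomology k l ≃ₗ[ℤ] (ι → ℤ)) := by
  obtain ⟨ι, hι, φ, hn, h1, h2, h3⟩ := h
  refine ⟨ι, hι, hn, ?_⟩
  let S := (G.magnitudeComplex l).sc' (k + 1) k (k - 1)
  let e := ((G.magnitudeComplex l).homologyIsoSc' (k + 1) k (k - 1) (by simp) (by simp)).toLinearEquiv
  let ψ : LinearMap.ker S.g.hom →ₗ[ℤ] (ι → ℤ) :=
    φ ∘ₗ G.magnitudeIncl k l ∘ₗ (LinearMap.ker S.g.hom).subtype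
  have hg : ∀ z : G.MagnitudeChain k l, z ∈ LinearMap.ker S.g.hom ↔
      D d (G.magnitudeIncl k l z) = 0 := by
    intro z
    rw [← neg_eq_zero, ← G.magnitudeIncl_magnitudeD hG hd hd0 rfl,
      map_eq_zero_iff _ (G.magnitudeIncl_injective _ _)]
    rfl
  have hD := fun y => G.magnitudeIncl_magnitudeD hG hd hd0 (l := l)
    (show k = k + 1 - 1 by ring) y
  have hψ : Function.Surjective ψ := by
    intro v
    obtain ⟨z, hz, hDz, rfl⟩ := h3 v
    obtain ⟨z, rfl⟩ := G.exists_magnitudeIncl_eq hG hz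
    exact ⟨⟨z, (hg z).2 hDz⟩, rfl⟩
  have hker : LinearMap.range S.moduleCatToCycles = LinearMap.ker ψ := by
    ext ⟨z, hz⟩
    constructor
    · rintro ⟨y, hy⟩
      have hy' : G.magnitudeD l (k + 1) k y = z := congrArg Subtype.val hy
      have h4 : φ (-D d (G.magnitudeIncl (k + 1) l y)) = 0 := by
        rw [map_neg, h1 _ (G.magnitudeIncl_mem hG y), neg_zero]
      exact (congrArg (fun t => φ (G.magnitudeIncl k l t)) hy').symm.trans
        ((congrArg φ (hD y)).trans h4)
    · intro h
      obtain ⟨y, hy, hDy⟩ := h2 _ (G.magnitudeIncl_mem hG z) ((hg z).1 hz) h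
      obtain ⟨y, rfl⟩ := G.exists_magnitudeIncl_eq hG hy
      -- The minus sign compensates for the opposite sign conventions of the two differentials.
      refine ⟨-y, Subtype.ext (G.magnitudeIncl_injective k l ((hD (-y)).trans ?_))⟩
      rw [map_neg, map_neg, neg_neg]
      exact hDy
  obtain ⟨f⟩ := nonempty_homology_equiv S ψ hψ hker
  exact ⟨e.trans f⟩

end SimpleGraph

/-! ### Even cycles -/

namespace CyclicStep

variable {V : Type} {m : ℕ} {d : V → V → ℕ} (C : CyclicStep m d)

theorem edist_le (G : SimpleGraph V) (hG : ∀ x, G.Adj x (C.s x)) (n : ℕ) (x y : V)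
    (h : C.p x y = n) : G.edist x y ≤ n := by
  induction n generalizing x with
  | zero => rw [(C.eq_zero x y).1 h]; simp
  | succ n ih =>
    have h1 := ih (C.s x) (by rw [C.p_s_left (by omega), h]; simp)
    have h2 : G.edist x (C.s x) ≤ 1 := SimpleGraph.edist_le_one_iff_adj_or_eq.2 (Or.inl (hG x))
    calc G.edist x y ≤ G.edist x (C.s x) + G.edist (C.s x) y := G.edist_triangle
      _ ≤ 1 + n := add_le_add h2 h1
      _ = _ := by push_cast; rw [add_comm]

/-- One edge changes the forward count by one modulo `2 * m`, hence decreases `d` by at most one. -/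
theorem le_walk_length (G : SimpleGraph V) (hG : ∀ x y, G.Adj x y → C.p x y = 1 ∨ C.p y x = 1)
    {x y : V} (w : G.Walk x y) : d x y ≤ w.length := by
  induction w with
  | nil => rw [C.d_self]; exact Nat.zero_le _
  | @cons x y z h w ih =>
    rw [SimpleGraph.Walk.length_cons]
    rw [C.d_eq] at ih ⊢
    have := C.p_add_swap h.ne
    have := hG x y h
    have := C.add x y z
    have := C.lt x z
    have := C.lt y z
    omega

theorem edist_eq (hm : 0 < m) (G : SimpleGraph V)
    (hG : ∀ x y, G.Adj x y ↔ C.p x y = 1 ∨ C.p y x = 1) (x y : V) : G.edist x y = d x y := by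
  refine le_antisymm ?_ ?_
  · by_cases h : x = y
    · subst h; simp
    -- The upper bound comes from going around in either direction and taking the shorter way.
    have h1 := C.edist_le G (fun x => (hG _ _).2 (Or.inl (C.p_s x))) _ x y rfl
    have h2 := (C.op hm).edist_le G (fun x => (hG _ _).2 (Or.inr (C.p_pr x))) _ x y rfl
    have h3 := C.p_add_swap h
    rw [C.d_eq]
    rcases min_choice (C.p x y) (2 * m - C.p x y) with h4 | h4 <;> rw [h4]
    · exact h1
    · rwa [← h3, Nat.add_sub_cancel_left]
  · rw [SimpleGraph.edist_eq_sInf]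
    refine le_sInf ?_
    rintro _ ⟨w, rfl⟩
    exact Nat.cast_le.2 <| C.le_walk_length G (fun x y h => (hG x y).1 h) w

end CyclicStep

/-- The number of positive steps from `x` to `y` on the cycle with `n` vertices. -/
def cycleStepCount {n : ℕ} (x y : Fin n) : ℕ :=
  if x.1 ≤ y.1 then y.1 - x.1 else y.1 + n - x.1

theorem val_sub_eq_cycleStepCount {n : ℕ} (x y : Fin n) : (y - x).val = cycleStepCount x y := by
  have := x.2
  have := y.2
  rw [Fin.sub_def, cycleStepCount]
  simp only
  split_ifs with h
  · rw [show n - x.1 + y.1 = y.1 - x.1 + n by omega, Nat.add_mod_right, Nat.mod_eq_of_lt (by omega)]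
  · rw [Nat.mod_eq_of_lt (by omega)]
    omega

/-- The vertices of the cycle with `2 * m` vertices in their cyclic order. -/
def evenCycleStep (m : ℕ) (hm : 3 ≤ m) : CyclicStep m fun x y : Fin (2 * m) =>
    min (cycleStepCount x y) (2 * m - cycleStepCount x y) where
  p := cycleStepCount
  s x := if h : x.1 + 1 < 2 * m then ⟨x.1 + 1, h⟩ else ⟨0, by omega⟩
  pr x := if x.1 = 0 then ⟨2 * m - 1, by omega⟩ else ⟨x.1 - 1, by omega⟩
  ant x := if h : x.1 + m < 2 * m then ⟨x.1 + m, h⟩ else ⟨x.1 - m, by omega⟩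
  lt x y := by have := x.2; have := y.2; unfold cycleStepCount; split_ifs <;> omega
  eq_zero x y := by
    have := x.2; have := y.2; rw [Fin.ext_iff]; unfold cycleStepCount; split_ifs <;> omega
  add x y z := by
    have := x.2; have := y.2; have := z.2; unfold cycleStepCount; split_ifs <;> omega
  p_s x := by
    have := x.2; unfold cycleStepCount; split_ifs <;> simp_all <;> omega
  p_pr x := by
    have := x.2; unfold cycleStepCount; split_ifs <;> simp_all <;> omega
  p_ant x := by
    have := x.2; unfold cycleStepCount; split_ifs <;> simp_all <;> omega
  d_eq _ _ := rfl

/-! ### The recursion for the ranks -/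

theorem evenCycleRank_neg (m : ℕ) {k l : ℤ} (h : k < 0 ∨ l < 0) : evenCycleRank m k l = 0 := by
  rw [evenCycleRank, if_pos h]

theorem evenCycleRank_origin (m : ℕ) : evenCycleRank m 0 0 = 2 * m := by
  rw [evenCycleRank, if_neg (by omega), if_pos (by omega)]

theorem evenCycleRank_one_one (m : ℕ) : evenCycleRank m 1 1 = 4 * m := by
  rw [evenCycleRank, if_neg (by omega), if_neg (by omega), if_pos (by omega)]

theorem evenCycleRank_eq_max (m : ℕ) {k l : ℤ} (hk : 0 ≤ k) (hl : 0 ≤ l) (h0 : k ≠ 0 ∨ l ≠ 0)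
    (h1 : k ≠ 1 ∨ l ≠ 1) : evenCycleRank m k l =
      max (evenCycleRank m (k - 1) (l - 1)) (evenCycleRank m (k - 2) (l - m)) := by
  rw [evenCycleRank, if_neg (by omega), if_neg (by omega), if_neg (by omega)]

theorem evenCycleRank_nonneg (m : ℕ) (n : ℕ) {k l : ℤ} (hk : k < n) : 0 ≤ evenCycleRank m k l := by
  induction n generalizing k l with
  | zero => rw [evenCycleRank_neg m (by left; simpa using hk)]
  | succ n ih =>
    push_cast at hk
    rw [evenCycleRank]
    split_ifs
    · rfl
    · positivity
    · positivity
    · exact le_max_of_le_left (ih (by omega))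

/-- Used to decide which argument of the maximum wins off the diagonal. -/
theorem evenCycleRank_mono (m : ℕ) (k l : ℤ) :
    evenCycleRank m (k - 1) (l - 1) ≤ evenCycleRank m k l := by
  by_cases h : k - 1 < 0 ∨ l - 1 < 0
  · rw [evenCycleRank_neg m h]
    exact evenCycleRank_nonneg m (k.toNat + 1) (by omega)
  by_cases h1 : k = 1 ∧ l = 1
  · obtain ⟨rfl, rfl⟩ := h1
    rw [sub_self, evenCycleRank_origin, evenCycleRank_one_one]
    omega
  rw [evenCycleRank_eq_max m (k := k) (l := l) (by omega) (by omega) (by omega) (by omega)]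
  exact le_max_left _ _

theorem evenCycleRank_zero_left (m : ℕ) {l : ℤ} (hl : l ≠ 0) : evenCycleRank m 0 l = 0 := by
  by_cases h : l < 0
  · exact evenCycleRank_neg m (Or.inr h)
  rw [evenCycleRank_eq_max m le_rfl (by omega) (by omega) (by omega),
    evenCycleRank_neg m (by omega), evenCycleRank_neg m (by omega), max_self]

theorem evenCycleRank_of_lt {m : ℕ} (hm : 3 ≤ m) (n : ℕ) {k l : ℤ} (hk : k < n) (hl : l < k) :
    evenCycleRank m k l = 0 := by
  induction n generalizing k l with
  | zero => exact evenCycleRank_neg m (by left; simpa using hk)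
  | succ n ih =>
    push_cast at hk
    by_cases h : k < 0 ∨ l < 0
    · exact evenCycleRank_neg m h
    rw [evenCycleRank_eq_max m (by omega) (by omega) (by omega) (by omega),
      ih (by omega) (by omega), ih (by omega) (by omega), max_self]

theorem evenCycleRank_diag {m : ℕ} (hm : 3 ≤ m) (n : ℕ) :
    evenCycleRank m (n + 1) (n + 1) = 4 * m := by
  induction n with
  | zero => simpa using evenCycleRank_one_one m
  | succ n ih =>
    push_cast
    rw [evenCycleRank_eq_max m (by omega) (by omega) (by omega) (by omega), add_sub_cancel_right,
      ih, evenCycleRank_of_lt hm (n + 1) (by push_cast; omega) (by omega)]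
    omega

/-- Off the diagonal, the rank function is periodic. -/
theorem evenCycleRank_step {m : ℕ} (n : ℕ) {k l : ℤ} (hkn : k ≤ n) (hk : 1 ≤ k) (hkl : l ≠ k) :
    evenCycleRank m k l = evenCycleRank m (k - 2) (l - m) := by
  induction n generalizing k l with
  | zero => push_cast at hkn; omega
  | succ n ih =>
    push_cast at hkn
    by_cases hl : l < 0
    · rw [evenCycleRank_neg m (by omega), evenCycleRank_neg m (by omega)]
    rw [evenCycleRank_eq_max m (by omega) (by omega) (by omega) (by omega)]
    refine max_eq_right ?_
    by_cases h1 : k = 1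
    · subst h1
      rw [sub_self, evenCycleRank_zero_left m (by omega), evenCycleRank_neg m (by omega)]
    -- By induction the first argument of the maximum is the value at `(k - 3, l - m - 1)`, one
    -- diagonal step below the second.
    · rw [ih (by omega) (by omega) (by omega)]
      have := evenCycleRank_mono m (k - 2) (l - m)
      rwa [show k - 1 - 2 = k - 2 - 1 by ring, show l - 1 - m = l - m - 1 by ring]

/-! ### Assembly: ranks, torsion-freeness and finite generation -/

theorem CyclicStep.exists_hasFreeHomology {m : ℕ} {d : Fin (2 * m) → Fin (2 * m) → ℕ}
    (C : CyclicStep m d) (hm : 3 ≤ m) (hDD : ∀ k l, ∀ z ∈ Chains d k l, D d (D d z) = 0)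
    (n : ℕ) (k l : ℤ) (hk : k < n) :
    ∃ r : ℕ, (r : ℤ) = evenCycleRank m k l ∧ HasFreeHomology d k l r := by
  induction n generalizing k l with
  | zero =>
    refine ⟨0, ?_, hasFreeHomology_zero d fun w hw => ?_⟩
    · rw [evenCycleRank_neg m (by left; simpa using hk)]; rfl
    · have := Sq.nonneg d hw
      push_cast at hk
      omega
  | succ n ih =>
    push_cast at hk
    by_cases hk0 : k < 0
    · exact ih k l (by omega)
    by_cases hkl : l = k
    · subst hkl
      by_cases hl : l = 0
      · subst hl
        refine ⟨_, ?_, C.hasFreeHomology_origin⟩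
        rw [evenCycleRank_origin, Fintype.card_fin]
        push_cast
        rfl
      · obtain ⟨a, rfl⟩ : ∃ a : ℕ, l = a + 1 := ⟨(l - 1).toNat, by omega⟩
        refine ⟨_, ?_, C.hasFreeHomology_diag hm hDD a⟩
        rw [evenCycleRank_diag hm, Fintype.card_fin]
        push_cast
        ring
    by_cases hk1 : k = 0
    · subst hk1
      refine ⟨0, by rw [evenCycleRank_zero_left m hkl]; rfl, hasFreeHomology_zero d fun w hw => ?_⟩
      match w, hw with
      | [x], hw => exact hkl hw.2
      | x :: y :: w, hw =>
        have := hw.one_le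
        omega
    obtain ⟨r, hr, h⟩ := ih (k - 2) (l - m) (by omega)
    exact ⟨r, hr.trans (evenCycleRank_step k.toNat (by omega) (by omega) hkl).symm,
      C.hasFreeHomology_step hm hDD (by omega) hkl h⟩

theorem exists_magnitudeHomology_evenCycle_equiv (m : ℕ) (hm : 3 ≤ m) (k l : ℤ) :
    ∃ (ι : Type) (_ : Fintype ι), (Fintype.card ι : ℤ) = evenCycleRank m k l ∧
      Nonempty ((SimpleGraph.cycleGraph (2 * m)).magnitudeHomology k l ≃ₗ[ℤ] (ι → ℤ)) := by
  let C := evenCycleStep m hm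
  have hG := C.edist_eq (by omega) (SimpleGraph.cycleGraph (2 * m)) fun x y => by
    rw [SimpleGraph.cycleGraph_adj', val_sub_eq_cycleStepCount, val_sub_eq_cycleStepCount, or_comm]
    rfl
  have hDD := SimpleGraph.D_D_eq_zero _ hG C.d_pos C.d_self
  obtain ⟨r, hr, h⟩ := C.exists_hasFreeHomology hm hDD (k.toNat + 1) k l (by omega)
  obtain ⟨ι, hι, hι', e⟩ := SimpleGraph.exists_magnitudeHomology_equiv _ hG C.d_pos C.d_self h
  exact ⟨ι, hι, by rw [hι', hr], e⟩

theorem mainTheorem4 (m : ℕ) (hm : 3 ≤ m) :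
    (∀ k l : ℤ,
      Module.IsTorsionFree ℤ ((SimpleGraph.cycleGraph (2 * m)).magnitudeHomology k l)) ∧
    (∀ k l : ℤ,
      Module.Finite ℤ ((SimpleGraph.cycleGraph (2 * m)).magnitudeHomology k l) ∧
      (Module.finrank ℤ ((SimpleGraph.cycleGraph (2 * m)).magnitudeHomology k l) : ℤ) =
        evenCycleRank m k l) := by
  refine ⟨fun k l => ?_, fun k l => ?_⟩ <;>
    obtain ⟨ι, _, hr, ⟨e⟩⟩ := exists_magnitudeHomology_evenCycle_equiv m hm k l
  · exact e.injective.moduleIsTorsionFree e (by simp)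
  · exact ⟨Module.Finite.equiv e.symm, by rw [e.finrank_eq, Module.finrank_pi, hr]⟩
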